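/- Let $N$ be a natural number and let $\beta,\delta,L>0$ satisfy $(\beta\delta)^{1/12}<L/3$. Consider $N$ non-interacting particles of unit mass in the cube $(-L/2,L/2)^3$, with positions $q_j=(q_j^1,q_j^2,q_j^3)$, $q_j^3=z_j$, momenta $p_j\in\mathbb R^3$, phase space $\mathcal M=(-L/2,L/2)^{3N}\times\mathbb R^{3N}$, and Hamiltonian $$H_0=\sum_{j=1}^N\frac{|p_j|^2}{2}+\sum_{j=1}^N\tilde V(z_j),\qquad \tilde V(z)=\delta\left[\left(\frac1{z+L/2}\right)^{12}+\left(\frac1{z-L/2}\right)^{12}\right],$$ the vertical walls of the box reflecting the particles elastically. Let $\rho_0=e^{-\beta H_0}/Z_0$ be the Gibbs probability density of $H_0$ on $\mathcal M$. At time $0$ the perturbation $-hA$, $A=\sum_{j}z_j$, $h>0$, is switched on; let $\rho(t)$, $t\ge 0$, be the classical solution of Liouville's equation $\partial_t\rho=[H_0-hA,\rho]$ with $\rho(0)=\rho_0$, where $[f,g]=\sum(\partial_q f\,\partial_p g-\partial_p f\,\partial_q g)$. Put $B=[A,H_0]$, $\langle B\rangle(t)=\int_{\mathcal M}B\,\rho(t)\,dp\,dq$,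 $\Delta\langle B\rangle(t)=\langle B\rangle(t)-\langle B\rangle(0)$, and $$t_{relax}=\sup\left\{t^*:\ \frac{d}{dt}\Delta\langle B\rangle(t)\ge 0\ \text{ for all } 0<t<t^*\right\}.$$ Then for all sufficiently small $h>0$ the solution $\rho$ exists, the integrals defining $\langle B\rangle(t)$, $t\ge0$, converge absolutely (whichever classical solution is taken), and $$t_{relax}\ \ge\ t_0=\frac1c\,(\beta\delta)^{1/24}\sqrt{L\beta},\qquad c=24\left(\int_0^{\infty}u^{13/12}e^{-u}\,du\right)^{1/2},$$ where $c\approx 25$ in the sense that $|c-25|<1$. -/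

import Mathlib

open Filter Topology MeasureTheory Set

noncomputable section

namespace GasInBox

/-- Phase points `x = (q, p)` of `N` particles in space: `x.1 j α` is the position coordinate
`q_j^α` and `x.2 j α` the momentum coordinate `p_j^α`.  The vertical direction is `α = 2`,
i.e. `z_j = x.1 j 2`. -/
abbrev Phase (N : ℕ) : Type := (Fin N → Fin 3 → ℝ) × (Fin N → Fin 3 → ℝ)

/-- The phase space: all positions in the open cube `(-L/2, L/2)^3`, arbitrary momenta. -/
def phaseSpace (N : ℕ) (L : ℝ) : Set (Phase N) :=
  {x | ∀ j α, x.1 j α ∈ Ioo (-(L / 2)) (L / 2)}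

/-- The phase space together with the vertical walls of the box.  (The horizontal walls
`z = ±L/2`, where the wall potential is infinite, are not added.) -/
def phaseSpaceWithWalls (N : ℕ) (L : ℝ) : Set (Phase N) :=
  {x | ∀ j, x.1 j 0 ∈ Icc (-(L / 2)) (L / 2) ∧ x.1 j 1 ∈ Icc (-(L / 2)) (L / 2) ∧
    x.1 j 2 ∈ Ioo (-(L / 2)) (L / 2)}

/-- Partial derivative with respect to `q_j^α`. -/
def partialQ {N : ℕ} (f : Phase N → ℝ) (j : Fin N) (α : Fin 3) (x : Phase N) : ℝ :=
  fderiv ℝ f x (Pi.single j (Pi.single α 1), 0)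

/-- Partial derivative with respect to `p_j^α`. -/
def partialP {N : ℕ} (f : Phase N → ℝ) (j : Fin N) (α : Fin 3) (x : Phase N) : ℝ :=
  fderiv ℝ f x (0, Pi.single j (Pi.single α 1))

/-- The Poisson bracket `[f, g] = ∑ (∂f/∂q ∂g/∂p - ∂f/∂p ∂g/∂q)`. -/
def poissonBracket {N : ℕ} (f g : Phase N → ℝ) (x : Phase N) : ℝ :=
  ∑ j, ∑ α, (partialQ f j α x * partialP g j α x - partialP f j α x * partialQ g j α x)

/-- Repulsive part of the Lennard-Jones potential of the two horizontal walls. -/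
def wallPotential (δ L z : ℝ) : ℝ :=
  δ * ((1 / (z + L / 2)) ^ 12 + (1 / (z - L / 2)) ^ 12)

/-- The unperturbed Hamiltonian. -/
def H₀ (N : ℕ) (δ L : ℝ) (x : Phase N) : ℝ :=
  ∑ j, (∑ α, x.2 j α ^ 2) / 2 + ∑ j, wallPotential δ L (x.1 j 2)

/-- The observable `A = ∑ z_j`, the field conjugated to gravity. -/
def A (N : ℕ) (x : Phase N) : ℝ := ∑ j, x.1 j 2

/-- The total Hamiltonian `H₀ - h A`. -/
def H₁ (N : ℕ) (δ L h : ℝ) (x : Phase N) : ℝ := H₀ N δ L x - h * A N x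

/-- The observable `B = [A, H₀]`. -/
def B (N : ℕ) (δ L : ℝ) : Phase N → ℝ := poissonBracket (A N) (H₀ N δ L)

/-- The Gibbs density `exp (-β H) / Z` on the phase space. -/
def gibbsDensity {N : ℕ} (β L : ℝ) (H : Phase N → ℝ) (x : Phase N) : ℝ :=
  Real.exp (-β * H x) / ∫ y in phaseSpace N L, Real.exp (-β * H y)

/-- Reversal of the momentum coordinate `p_j^α`. -/
def reflect {N : ℕ} (j : Fin N) (α : Fin 3) (x : Phase N) : Phase N :=
  (x.1, Function.update x.2 j (Function.update (x.2 j) α (-x.2 j α)))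

/-- `ρ` is a (classical) solution, for times `t ≥ 0`, of Liouville's equation `∂ρ/∂t = [H, ρ]`
in the box with initial datum `init`.  The vertical walls reflect the particles elastically. -/
structure IsLiouvilleSolution {N : ℕ} (L : ℝ) (H init : Phase N → ℝ)
    (ρ : ℝ → Phase N → ℝ) : Prop where
  continuousOn : ContinuousOn (fun y : ℝ × Phase N => ρ y.1 y.2)
    (Ici 0 ×ˢ phaseSpaceWithWalls N L)
  differentiableAt : ∀ t, 0 < t → ∀ x ∈ phaseSpace N L,
    DifferentiableAt ℝ (fun y : ℝ × Phase N => ρ y.1 y.2) (t, x)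
  liouville : ∀ t, 0 < t → ∀ x ∈ phaseSpace N L,
    deriv (fun s => ρ s x) t = poissonBracket H (ρ t) x
  reflection : ∀ t, 0 ≤ t → ∀ x ∈ phaseSpaceWithWalls N L, ∀ j, ∀ α : Fin 3, α ≠ 2 →
    |x.1 j α| = L / 2 → ρ t (reflect j α x) = ρ t x
  initial : ∀ x ∈ phaseSpace N L, ρ 0 x = init x

/-- The expectation of the observable `f` at time `t`. -/
def mean {N : ℕ} (L : ℝ) (f : Phase N → ℝ) (ρ : ℝ → Phase N → ℝ) (t : ℝ) : ℝ :=
  ∫ x in phaseSpace N L, f x * ρ t x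

/-- The increment of the expectation of the observable `f`. -/
def meanIncrement {N : ℕ} (L : ℝ) (f : Phase N → ℝ) (ρ : ℝ → Phase N → ℝ) (t : ℝ) : ℝ :=
  mean L f ρ t - mean L f ρ 0

/-- The relaxation time: the supremum of the `s` such that `g` is differentiable with
nonnegative derivative at all times `0 < t < s`, where `g` is the increment of the
expectation of `B`. -/
def relaxationTime (g : ℝ → ℝ) : EReal :=
  sSup {s : EReal | ∀ t : ℝ, 0 < t → (t : EReal) < s → DifferentiableAt ℝ g t ∧ 0 ≤ deriv g t}

/-- The numerical constant of the estimate. -/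
def c : ℝ := 24 * √(∫ u in Ioi (0 : ℝ), u ^ (13 / 12 : ℝ) * Real.exp (-u))

/-- The lower bound for the relaxation time. -/
def t₀ (β δ L : ℝ) : ℝ := 1 / c * (β * δ) ^ (1 / 24 : ℝ) * √(L * β)

end GasInBox

end

/-! Every solution is the Gibbs density transported by the perturbed dynamics. Free horizontal
motion with reflections preserves the horizontal kinetic energy, so only the vertical flow φ of one
particle in the tilted potential U = Ṽ - hz matters. Write (z₋ₜ, p₋ₜ) = φ₋ₜ(z, p) and let E be the
tilted energy p²/2 + U. Since φ conserves E, the transported vertical weight is exp(-β(E + h z₋ₜ)),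
and ⟨B⟩(t) is a nonnegative constant times ∫ p exp(-β(E + h z₋ₜ)) (`exists_mean_eq`). As z₋ₜ has
time derivative -p₋ₜ, the derivative of this integral is βh ∫ p p₋ₜ exp(-β(E + h z₋ₜ))
(`hasDerivAt_meanMomentum`), for small h essentially a momentum autocorrelation.

Now 2 p p₋ₜ = p² + p₋ₜ² - (p - p₋ₜ)². By Liouville's theorem p² and p₋ₜ² have the same Gibbs mean,
namely 1/β. By Cauchy-Schwarz in time and Liouville's theorem again, (p - p₋ₜ)² has mean at most t²
times the mean squared force (`integral_sq_sub_le`). So the autocorrelation is nonnegative as long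
as t²β⟨U'²⟩ ≤ 2, up to corrections that vanish with h (`integral_momentum_mul_nonneg`).

The substitution y = s⁻¹² bounds ∫ Ṽ'² exp(-βṼ) by 24 δ² (βδ)^(-25/12) Γ(25/12), and ∫ exp(-βṼ) is
at least (L/3) e⁻². With these bounds t₀²β⟨Ṽ'²⟩ ≤ e²/8 < 1, and the strict inequality absorbs the
effect of a weak field (`eventually_force_le`).

It remains to construct φ with Jacobian one, by cutting the Hamiltonian field off at high energies,
and to prove uniqueness: a solution is constant along trajectories reflected at the vertical walls,
which are obtained by folding straight lines (`eq_evolvedDensity`). -/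

theorem HasDerivWithinAt.prod_fst {f : ℝ → ℝ × ℝ} {f' : ℝ × ℝ} {s : Set ℝ} {t : ℝ}
    (h : HasDerivWithinAt f f' s t) : HasDerivWithinAt (fun r => (f r).1) f'.1 s t := by
  simpa [Function.comp_def] using
    (hasFDerivAt_fst (𝕜 := ℝ) (p := f t)).comp_hasDerivWithinAt t h

theorem HasDerivWithinAt.prod_snd {f : ℝ → ℝ × ℝ} {f' : ℝ × ℝ} {s : Set ℝ} {t : ℝ}
    (h : HasDerivWithinAt f f' s t) : HasDerivWithinAt (fun r => (f r).2) f'.2 s t := by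
  simpa [Function.comp_def] using
    (hasFDerivAt_snd (𝕜 := ℝ) (p := f t)).comp_hasDerivWithinAt t h

theorem HasDerivAt.prod_fst {f : ℝ → ℝ × ℝ} {f' : ℝ × ℝ} {t : ℝ}
    (h : HasDerivAt f f' t) : HasDerivAt (fun r => (f r).1) f'.1 t :=
  hasDerivWithinAt_univ.1 h.hasDerivWithinAt.prod_fst

theorem HasDerivAt.prod_snd {f : ℝ → ℝ × ℝ} {f' : ℝ × ℝ} {t : ℝ}
    (h : HasDerivAt f f' t) : HasDerivAt (fun r => (f r).2) f'.2 t :=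
  hasDerivWithinAt_univ.1 h.hasDerivWithinAt.prod_snd

/-! ### Global flows of bounded Lipschitz fields and their differentiability. -/

section LipschitzFlow

open scoped NNReal

variable {E : Type*} [NormedAddCommGroup E] [NormedSpace ℝ E]

theorem integralCurve_unique {v : E → E} {K : ℝ≥0} (hv : LipschitzWith K v) {f g : ℝ → E}
    (hf : ∀ t, HasDerivAt f (v (f t)) t) (hg : ∀ t, HasDerivAt g (v (g t)) t) {t₀ : ℝ}
    (h : f t₀ = g t₀) : f = g :=
  ODE_solution_unique_univ (v := fun _ => v) (s := fun _ => univ)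
    (fun _ => hv.lipschitzOnWith) (fun t => ⟨hf t, trivial⟩) (fun t => ⟨hg t, trivial⟩) h

theorem exists_integralCurve [CompleteSpace E] {v : E → E} {K M : ℝ≥0} (hv : LipschitzWith K v)
    (hM : ∀ x, ‖v x‖ ≤ M) (x : E) :
    ∃ γ : ℝ → E, γ 0 = x ∧ ∀ t, HasDerivAt γ (v (γ t)) t := by
  have loc : ∀ n : ℕ, ∃ γ : ℝ → E, γ 0 = x ∧
      ∀ t ∈ Ioo (-(n + 1) : ℝ) (n + 1), HasDerivAt γ (v (γ t)) t := by
    intro n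
    have h0 : (0 : ℝ) ∈ Icc (-(n + 1) : ℝ) (n + 1) := ⟨by linarith [n.cast_nonneg (α := ℝ)],
      by positivity⟩
    -- A field bounded by `M` moves a point by at most `M * (n + 1)` in this time, so a ball of that
    -- radius suffices.
    have hP : IsPicardLindelof (fun _ => v) (⟨0, h0⟩ : Icc (-(n + 1) : ℝ) (n + 1)) x
        (M * (n + 1)) 0 M K :=
      IsPicardLindelof.of_time_independent (fun y _ => hM y) hv.lipschitzOnWith (by simp)
    obtain ⟨γ, hγ0, hγ⟩ := hP.exists_eq_forall_mem_Icc_hasDerivWithinAt₀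
    exact ⟨γ, hγ0, fun t ht => (hγ t (Ioo_subset_Icc_self ht)).hasDerivAt (Icc_mem_nhds ht.1 ht.2)⟩
  choose Γ hΓ0 hΓ using loc
  have agree : ∀ m n : ℕ, m ≤ n → ∀ t ∈ Ioo (-(m + 1) : ℝ) (m + 1), Γ m t = Γ n t := by
    intro m n hmn
    have hmn' : (m : ℝ) ≤ n := by exact_mod_cast hmn
    have := ODE_solution_unique_of_mem_Ioo (v := fun _ => v) (s := fun _ => univ)
      (a := (-(m + 1) : ℝ)) (b := m + 1) (t₀ := 0) (f := Γ m) (g := Γ n)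
      (fun _ _ => hv.lipschitzOnWith (s := univ))
        ⟨by linarith [m.cast_nonneg (α := ℝ)], by positivity⟩
      (fun t ht => ⟨hΓ m t ht, trivial⟩)
      (fun t ht => ⟨hΓ n t ⟨by linarith [ht.1], by linarith [ht.2]⟩, trivial⟩)
      (by rw [hΓ0, hΓ0])
    exact this
  -- `Γ n` solves the equation for times below `n + 1` in modulus, hence around every `t` with `|t|
  -- ≤ n`.
  refine ⟨fun t => Γ ⌈|t|⌉₊ t, by simp [hΓ0], fun t => ?_⟩
  have key : ∀ s : ℝ, |s| < |t| + 1 → Γ ⌈|s|⌉₊ s = Γ (⌈|t|⌉₊ + 1) s := by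
    intro s hs
    refine agree _ _ ?_ s ?_
    · rw [Nat.ceil_le]; push_cast; linarith [Nat.le_ceil |t|]
    · have := abs_le.1 (Nat.le_ceil |s|)
      exact ⟨by linarith [this.1], by linarith [this.2]⟩
  have hev : (fun s => Γ ⌈|s|⌉₊ s) =ᶠ[𝓝 t] Γ (⌈|t|⌉₊ + 1) := by
    have : ∀ᶠ s in 𝓝 t, |s| < |t| + 1 :=
      continuous_abs.continuousAt.eventually (gt_mem_nhds (by linarith : |t| < |t| + 1))
    exact this.mono key
  refine (HasDerivAt.congr_of_eventuallyEq ?_ hev)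
  have e : (fun s => Γ ⌈|s|⌉₊ s) t = Γ (⌈|t|⌉₊ + 1) t := key t (by linarith)
  rw [e]
  refine hΓ _ t ?_
  have := abs_le.1 (Nat.le_ceil |t|)
  push_cast
  exact ⟨by linarith [this.1], by linarith [this.2]⟩

/-- `φ` is the global flow of the vector field `v`. -/
structure IsFlowOf (φ : ℝ → E → E) (v : E → E) : Prop where
  zero : ∀ x, φ 0 x = x
  hasDerivAt : ∀ t x, HasDerivAt (fun s => φ s x) (v (φ t x)) t

theorem exists_isFlowOf [CompleteSpace E] {v : E → E} {K M : ℝ≥0} (hv : LipschitzWith K v)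
    (hM : ∀ x, ‖v x‖ ≤ M) : ∃ φ : ℝ → E → E, IsFlowOf φ v := by
  choose Γ hΓ0 hΓ using exists_integralCurve hv hM
  exact ⟨fun t x => Γ x t, hΓ0, fun t x => hΓ x t⟩

namespace IsFlowOf

variable {φ : ℝ → E → E} {v : E → E} {K M : ℝ≥0}

theorem add (hφ : IsFlowOf φ v) (hv : LipschitzWith K v) (s t : ℝ) (x : E) :
    φ (s + t) x = φ s (φ t x) := by
  have := integralCurve_unique hv (f := fun s => φ (s + t) x) (g := fun s => φ s (φ t x))
    (fun r => (hφ.hasDerivAt (r + t) x).comp_add_const r t)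
    (fun r => hφ.hasDerivAt r _) (t₀ := 0) (by simp [hφ.zero])
  exact congrFun this s

theorem dist_le (hφ : IsFlowOf φ v) (hv : LipschitzWith K v) {t : ℝ} (ht : 0 ≤ t) (x y : E) :
    dist (φ t x) (φ t y) ≤ dist x y * Real.exp (K * t) := by
  have := dist_le_of_trajectories_ODE (v := fun _ => v) (K := K) (f := fun s => φ s x)
    (g := fun s => φ s y) (a := 0) (b := t) (δ := dist x y) (fun _ => hv)
    (fun r _ => (hφ.hasDerivAt r x).continuousAt.continuousWithinAt)
    (fun r _ => (hφ.hasDerivAt r x).hasDerivWithinAt)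
    (fun r _ => (hφ.hasDerivAt r y).continuousAt.continuousWithinAt)
    (fun r _ => (hφ.hasDerivAt r y).hasDerivWithinAt) (by simp [hφ.zero]) t ⟨ht, le_rfl⟩
  simpa using this

theorem norm_sub_le (hφ : IsFlowOf φ v) (hM : ∀ x, ‖v x‖ ≤ M) (t : ℝ) (x : E) :
    ‖φ t x - x‖ ≤ M * |t| := by
  have := Convex.norm_image_sub_le_of_norm_hasDerivWithin_le (f := fun s => φ s x) (s := univ)
    (x := 0) (y := t) (C := M) (fun r _ => (hφ.hasDerivAt r x).hasDerivWithinAt) (fun r _ => hM _)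
    convex_univ
    trivial trivial
  simpa [hφ.zero] using this

/-- The flow is jointly differentiable at time zero. -/
theorem hasFDerivAt_zero (hφ : IsFlowOf φ v) (hv : LipschitzWith K v) (hM : ∀ x, ‖v x‖ ≤ M)
    (w : E) : HasFDerivAt (fun y : ℝ × E => φ y.1 y.2)
      (ContinuousLinearMap.snd ℝ ℝ E + (ContinuousLinearMap.fst ℝ ℝ E).smulRight (v w)) (0, w) := by
  -- Freezing the field at `w` costs `K` times the distance of the trajectory from `w`, so the error
  -- is quadratic in `(s, y - w)`.
  have bound : ∀ s : ℝ, ∀ y : E, ‖φ s y - y - s • v w‖ ≤ K * (M * |s| + ‖y - w‖) * |s| := by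
    intro s y
    have := Convex.norm_image_sub_le_of_norm_hasDerivWithin_le
      (f := fun r => φ r y - r • v w) (f' := fun r => v (φ r y) - v w) (s := uIcc 0 s)
      (x := 0) (y := s) (C := K * (M * |s| + ‖y - w‖))
      (fun r _ => ((hφ.hasDerivAt r y).sub
      (by simpa using (hasDerivAt_id r).smul_const (v w))).hasDerivWithinAt)
      (fun r hr => ?_) (convex_uIcc _ _) left_mem_uIcc right_mem_uIcc
    · simpa [hφ.zero, sub_right_comm] using this
    · have h1 := hv.dist_le_mul (φ r y) w
      rw [dist_eq_norm, dist_eq_norm] at h1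
      refine h1.trans (mul_le_mul_of_nonneg_left ?_ K.2)
      have h2 := hφ.norm_sub_le hM r y
      have h3 : |r| ≤ |s| := by
        have := abs_sub_left_of_mem_uIcc hr
        simpa using this
      calc ‖φ r y - w‖ = ‖(φ r y - y) + (y - w)‖ := by congr 1; abel
        _ ≤ ‖φ r y - y‖ + ‖y - w‖ := norm_add_le _ _
        _ ≤ M * |s| + ‖y - w‖ := by
          gcongr
          exact h2.trans (by gcongr)
  rw [hasFDerivAt_iff_isLittleO_nhds_zero]
  have hbig : (fun h : ℝ × E => φ ((0, w) + h).1 ((0, w) + h).2 - φ (0, w).1 (0, w).2 -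
      (ContinuousLinearMap.snd ℝ ℝ E + (ContinuousLinearMap.fst ℝ ℝ E).smulRight (v w)) h)
      =O[𝓝 0] fun h : ℝ × E => ‖h‖ ^ 2 := by
    refine Asymptotics.IsBigO.of_bound (K * (M + 1)) (Eventually.of_forall fun h => ?_)
    have h1 := bound h.1 (w + h.2)
    have e : φ ((0, w) + h).1 ((0, w) + h).2 - φ (0, w).1 (0, w).2 -
      (ContinuousLinearMap.snd ℝ ℝ E + (ContinuousLinearMap.fst ℝ ℝ E).smulRight (v w)) h =
      φ h.1 (w + h.2) - (w + h.2) - h.1 • v w := by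
      simp [hφ.zero]; abel
    rw [e]
    refine h1.trans ?_
    have a1 : |h.1| ≤ ‖h‖ := norm_fst_le h
    have a2 : ‖h.2‖ ≤ ‖h‖ := norm_snd_le h
    rw [add_sub_cancel_left, Real.norm_of_nonneg (by positivity)]
    calc K * (M * |h.1| + ‖h.2‖) * |h.1| ≤ K * (M * ‖h‖ + ‖h‖) * ‖h‖ := by gcongr
      _ = _ := by ring
  refine hbig.trans_isLittleO ?_
  have := Asymptotics.isLittleO_norm_pow_id (E' := ℝ × E) (n := 2) one_lt_two
  simpa using this

/-- Differentiability of the flow map with respect to the initial point for short times, together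
with the variational equation. -/
theorem exists_hasFDerivAt_of_short_time [CompleteSpace E] (hφ : IsFlowOf φ v)
    (hv : LipschitzWith K v) {v' : E → E →L[ℝ] E} (hv' : ∀ x, HasFDerivAt v (v' x) x) {K' : ℝ≥0}
    (hK' : LipschitzWith K' v') {τ : ℝ} (hτ0 : 0 ≤ τ) (hτ : 2 * K * τ ≤ 1) (x : E) :
    ∃ Y : ℝ → E →L[ℝ] E, Y 0 = ContinuousLinearMap.id ℝ E ∧
      (∀ t ∈ Icc 0 τ, HasDerivWithinAt Y (v' (φ t x) ∘L Y t) (Icc 0 τ) t) ∧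
      ∀ t ∈ Icc 0 τ, HasFDerivAt (φ t) (Y t) x := by
  have hbd : ∀ y, ‖v' y‖ ≤ K := fun y => (hv' y).le_of_lipschitz hv
  have hcont : Continuous fun t => φ t x :=
    continuous_iff_continuousAt.2 fun t => (hφ.hasDerivAt t x).continuousAt
  -- The linear variational equation is solved in the unit ball around the identity. There `‖Y‖ ≤
  -- 2`, so the speed is at most `2 * K`; this is where `2 * K * τ ≤ 1` is needed.
  have hP : IsPicardLindelof (fun t (Y : E →L[ℝ] E) => v' (φ t x) ∘L Y)
      (⟨0, ⟨le_rfl, hτ0⟩⟩ : Icc (0 : ℝ) τ) (ContinuousLinearMap.id ℝ E) 1 0 (2 * K) K := by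
    refine ⟨fun t _ => LipschitzWith.lipschitzOnWith ?_, fun Y _ => ?_, fun t _ Y hY => ?_, ?_⟩
    · refine LipschitzWith.of_dist_le_mul fun Y Z => ?_
      rw [dist_eq_norm, dist_eq_norm, ← ContinuousLinearMap.comp_sub]
      exact (ContinuousLinearMap.opNorm_comp_le _ _).trans (by gcongr; exact hbd _)
    · exact ((hK'.continuous.comp hcont).clm_comp continuous_const).continuousOn
    · have h1 : ‖Y‖ ≤ 2 := by
        have h2 : ‖Y - ContinuousLinearMap.id ℝ E‖ ≤ 1 := by simpa [dist_eq_norm] using hY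
        have h3 : ‖ContinuousLinearMap.id ℝ E‖ ≤ 1 := ContinuousLinearMap.norm_id_le
        calc ‖Y‖ = ‖(Y - ContinuousLinearMap.id ℝ E) + ContinuousLinearMap.id ℝ E‖ := by simp
          _ ≤ 1 + 1 := (norm_add_le _ _).trans (by gcongr)
          _ = 2 := by norm_num
      refine (ContinuousLinearMap.opNorm_comp_le _ _).trans ?_
      push_cast
      rw [mul_comm]
      exact mul_le_mul h1 (hbd _) (norm_nonneg _) zero_le_two
    · simpa [hτ0] using hτ
  obtain ⟨Y, hY0, hY⟩ := hP.exists_eq_forall_mem_Icc_hasDerivWithinAt₀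
  refine ⟨Y, hY0, hY, fun t ht => ?_⟩
  have quad : ∀ a b, ‖v b - v a - v' a (b - a)‖ ≤ K' * ‖b - a‖ ^ 2 := by
    intro a b
    have := (convex_segment a b).norm_image_sub_le_of_norm_hasFDerivWithin_le' (f := v) (f' := v')
      (φ := v' a) (C := K' * ‖b - a‖) (fun z _ => (hv' z).hasFDerivWithinAt) (fun z hz => ?_)
      (left_mem_segment ℝ a b) (right_mem_segment ℝ a b)
    · refine this.trans (le_of_eq (by ring))
    · have h1 := hK'.dist_le_mul z a
      rw [dist_eq_norm, dist_eq_norm] at h1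
      refine h1.trans (mul_le_mul_of_nonneg_left ?_ K'.2)
      exact norm_sub_le_of_mem_segment hz
  set C : ℝ := K' * Real.exp (K * τ) ^ 2 with hC
  -- Grönwall: the linearisation error solves the variational equation up to the Taylor remainder of
  -- `v`, which is quadratic in `‖y‖` because trajectories separate by a factor of at most `exp (K *
  -- τ)`.
  have main : ∀ y, ‖φ t (x + y) - φ t x - Y t y‖ ≤
      gronwallBound 0 K 1 t * (C * ‖y‖ ^ 2) := by
    intro y
    have hd : ∀ s ∈ Icc 0 τ, HasDerivWithinAt (fun s => φ s (x + y) - φ s x - Y s y)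
        (v (φ s (x + y)) - v (φ s x) - v' (φ s x) (Y s y)) (Icc 0 τ) s := by
      intro s hs
      refine ((hφ.hasDerivAt s _).sub (hφ.hasDerivAt s x)).hasDerivWithinAt.sub ?_
      have := (hY s hs).clm_apply (hasDerivWithinAt_const s (Icc 0 τ) y)
      simpa using this
    have hc : ContinuousOn (fun s => φ s (x + y) - φ s x - Y s y) (Icc 0 t) := fun s hs =>
      ((hd s ⟨hs.1, hs.2.trans ht.2⟩).continuousWithinAt).mono (Icc_subset_Icc_right ht.2)
    have := norm_le_gronwallBound_of_norm_deriv_right_le (δ := 0) (K := K) (ε := C * ‖y‖ ^ 2) hc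
      (f' := fun s => v (φ s (x + y)) - v (φ s x) - v' (φ s x) (Y s y)) (fun s hs => ?_) ?_ ?_ t
      ⟨ht.1, le_rfl⟩
    · refine this.trans (le_of_eq ?_)
      by_cases hK0 : (K : ℝ) = 0
      · rw [hK0, gronwallBound_K0, gronwallBound_K0]; ring
      · simp only [gronwallBound_of_K_ne_0 hK0, zero_mul, zero_add, sub_zero]; ring
    · refine (hd s ⟨hs.1, hs.2.le.trans ht.2⟩).mono_of_mem_nhdsWithin ?_
      exact mem_of_superset (Icc_mem_nhdsGE_of_mem ⟨hs.1, hs.2⟩)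
        (Icc_subset_Icc_right ht.2)
    · simp [hφ.zero, hY0]
    · intro s hs
      have e : v (φ s (x + y)) - v (φ s x) - v' (φ s x) (Y s y) =
          v' (φ s x) (φ s (x + y) - φ s x - Y s y) +
          (v (φ s (x + y)) - v (φ s x) - v' (φ s x) (φ s (x + y) - φ s x)) := by
        simp only [map_sub]; abel
      rw [e]
      refine (norm_add_le _ _).trans (add_le_add ?_ ?_)
      · exact (ContinuousLinearMap.le_opNorm _ _).trans (by gcongr; exact hbd _)
      · refine (quad _ _).trans ?_
        have h1 := hφ.dist_le hv hs.1 (x + y) x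
        rw [dist_eq_norm, dist_eq_norm, add_sub_cancel_left] at h1
        have h2 : Real.exp (K * s) ≤ Real.exp (K * τ) := by
          gcongr; exact hs.2.le.trans ht.2
        calc K' * ‖φ s (x + y) - φ s x‖ ^ 2 ≤ K' * (‖y‖ * Real.exp (K * τ)) ^ 2 := by
              gcongr; exact h1.trans (by gcongr)
          _ = C * ‖y‖ ^ 2 := by rw [hC]; ring
  rw [hasFDerivAt_iff_isLittleO_nhds_zero]
  have hbig : (fun y : E => φ t (x + y) - φ t x - Y t y) =O[𝓝 0] fun y : E => ‖y‖ ^ 2 := by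
    refine Asymptotics.IsBigO.of_bound (gronwallBound 0 K 1 t * C)
      (Eventually.of_forall fun y => ?_)
    refine (main y).trans (le_of_eq ?_)
    rw [Real.norm_of_nonneg (by positivity)]; ring
  refine hbig.trans_isLittleO ?_
  have := Asymptotics.isLittleO_norm_pow_id (E' := E) (n := 2) one_lt_two
  simpa using this

/-- The group law writes `φ s y` as `φ (s - t) (φ t y)`, which reduces joint differentiability to
time zero. -/
theorem differentiableAt_uncurry (hφ : IsFlowOf φ v) (hv : LipschitzWith K v)
    (hM : ∀ x, ‖v x‖ ≤ M) {t : ℝ} {x : E} (h : DifferentiableAt ℝ (φ t) x) :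
    DifferentiableAt ℝ (fun y : ℝ × E => φ y.1 y.2) (t, x) := by
  have e : (fun y : ℝ × E => φ y.1 y.2) =
      (fun y : ℝ × E => φ y.1 y.2) ∘ fun y : ℝ × E => (y.1 - t, φ t y.2) := by
    ext y
    simp [← hφ.add hv]
  rw [e]
  have h0 := (hφ.hasFDerivAt_zero hv hM (φ t x)).differentiableAt
  refine DifferentiableAt.comp (t, x) (by simpa using h0) ?_
  refine (differentiableAt_fst.sub_const t).prodMk ?_
  exact DifferentiableAt.comp (t, x) (g := φ t) h differentiableAt_snd

theorem neg (hφ : IsFlowOf φ v) : IsFlowOf (fun t => φ (-t)) (fun x => -v x) where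
  zero x := by simp [hφ.zero]
  hasDerivAt t x := by
    have := (hφ.hasDerivAt (-t) x).scomp t (hasDerivAt_neg t)
    simpa [Function.comp_def] using this

end IsFlowOf

end LipschitzFlow

/-! ### Area preservation by divergence-free planar fields. -/

section PlanarFlow

open scoped NNReal ContDiff

theorem ContinuousLinearMap.det_prod_real (Y : ℝ × ℝ →L[ℝ] ℝ × ℝ) :
    Y.det = (Y (1, 0)).1 * (Y (0, 1)).2 - (Y (0, 1)).1 * (Y (1, 0)).2 := by
  rw [ContinuousLinearMap.det, ← LinearMap.det_toMatrix (Module.Basis.finTwoProd ℝ),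
    Matrix.det_fin_two]
  simp [LinearMap.toMatrix_apply]

/-- By the variational equation the determinant has derivative trace times determinant, which is
zero on the invariant set `G`. This works for times up to `τ`; longer times are cut into short steps
and the chain rule multiplies the determinants. -/
theorem IsFlowOf.exists_hasFDerivAt_det_eq_one {φ : ℝ → ℝ × ℝ → ℝ × ℝ} {v : ℝ × ℝ → ℝ × ℝ}
    {K : ℝ≥0} (hφ : IsFlowOf φ v) (hv : LipschitzWith K v) {v' : ℝ × ℝ → ℝ × ℝ →L[ℝ] ℝ × ℝ}
    (hv' : ∀ x, HasFDerivAt v (v' x) x) {K' : ℝ≥0} (hK' : LipschitzWith K' v')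
    {G : Set (ℝ × ℝ)} (hG : ∀ t, ∀ x ∈ G, φ t x ∈ G)
    (htr : ∀ x ∈ G, (v' x (1, 0)).1 + (v' x (0, 1)).2 = 0) {t : ℝ} (ht : 0 ≤ t) {x : ℝ × ℝ}
    (hx : x ∈ G) : ∃ Y : ℝ × ℝ →L[ℝ] ℝ × ℝ, HasFDerivAt (φ t) Y x ∧ Y.det = 1 := by
  -- The `+ 1` covers `K = 0`.
  set τ : ℝ := 1 / (2 * K + 1) with hτ
  have hτ0 : 0 < τ := by positivity
  have hτ1 : 2 * K * τ ≤ 1 := by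
    rw [hτ, mul_one_div, div_le_one (by positivity)]; linarith
  have short : ∀ s ∈ Icc 0 τ, ∀ x ∈ G,
      ∃ Y : ℝ × ℝ →L[ℝ] ℝ × ℝ, HasFDerivAt (φ s) Y x ∧ Y.det = 1 := by
    intro s hs x hx
    obtain ⟨Y, hY0, hY, hYd⟩ := hφ.exists_hasFDerivAt_of_short_time hv hv' hK' hτ0.le hτ1 x
    refine ⟨Y s, hYd s hs, ?_⟩
    have hd : ∀ r ∈ Icc 0 τ, HasDerivWithinAt (fun r => (Y r).det) 0 (Icc 0 τ) r := by
      intro r hr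
      have h1 : ∀ e : ℝ × ℝ,
          HasDerivWithinAt (fun r => Y r e) (v' (φ r x) (Y r e)) (Icc 0 τ) r := by
        intro e
        simpa using (hY r hr).clm_apply (hasDerivWithinAt_const r (Icc 0 τ) e)
      have h11 : ∀ e : ℝ × ℝ, HasDerivWithinAt (fun r => (Y r e).1) (v' (φ r x) (Y r e)).1
          (Icc 0 τ) r := fun e => (h1 e).prod_fst
      have h12 : ∀ e : ℝ × ℝ, HasDerivWithinAt (fun r => (Y r e).2) (v' (φ r x) (Y r e)).2
          (Icc 0 τ) r := fun e => (h1 e).prod_snd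
      have h2 := ((h11 (1, 0)).mul (h12 (0, 1))).sub ((h11 (0, 1)).mul (h12 (1, 0)))
      have hlin : ∀ u : ℝ × ℝ, v' (φ r x) u =
          u.1 • v' (φ r x) (1, 0) + u.2 • v' (φ r x) (0, 1) := by
        intro u
        rw [← map_smul, ← map_smul, ← map_add]
        simp
      have htr' := htr _ (hG r x hx)
      refine (h2.congr_deriv ?_).congr_of_mem (fun r _ => (Y r).det_prod_real) hr
      rw [hlin (Y r (1, 0)), hlin (Y r (0, 1))]
      simp only [Prod.fst_add, Prod.snd_add, Prod.smul_fst, Prod.smul_snd, smul_eq_mul]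
      linear_combination ((Y r (1, 0)).1 * (Y r (0, 1)).2 - (Y r (0, 1)).1 * (Y r (1, 0)).2) * htr'
    have := (convex_Icc (0 : ℝ) τ).norm_image_sub_le_of_norm_hasDerivWithin_le (C := 0) hd
      (by simp) ⟨le_rfl, hτ0.le⟩ hs
    have h0 : (Y s).det = (Y 0).det := by simpa [sub_eq_zero] using this
    rw [h0, hY0]
    simp [ContinuousLinearMap.det_prod_real]
  obtain ⟨n, hn⟩ := exists_nat_gt (t / τ)
  have hn0 : (0 : ℝ) < n := lt_of_le_of_lt (by positivity) hn
  have hs : t / n ∈ Icc 0 τ := ⟨by positivity, by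
    rw [div_le_iff₀ hn0, mul_comm, ← div_le_iff₀ hτ0]; exact hn.le⟩
  have iter : ∀ k : ℕ, ∀ x ∈ G,
      ∃ Y : ℝ × ℝ →L[ℝ] ℝ × ℝ, HasFDerivAt (φ (k * (t / n))) Y x ∧ Y.det = 1 := by
    intro k
    induction k with
    | zero =>
      intro x _
      refine ⟨ContinuousLinearMap.id ℝ _, ?_, by simp [ContinuousLinearMap.det_prod_real]⟩
      have : φ ((0 : ℕ) * (t / n)) = id := by ext1 y; simp [hφ.zero]
      rw [this]
      exact hasFDerivAt_id x
    | succ k ih =>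
      intro x hx
      obtain ⟨Y₁, h1, d1⟩ := short _ hs x hx
      obtain ⟨Y₂, h2, d2⟩ := ih _ (hG (t / n) x hx)
      refine ⟨Y₂ ∘L Y₁, ?_, ?_⟩
      · have e : φ ((k + 1 : ℕ) * (t / n)) = φ (k * (t / n)) ∘ φ (t / n) := by
          ext1 y
          rw [Function.comp_apply, ← hφ.add hv]
          congr 1; push_cast; ring
        rw [e]
        exact h2.comp x h1
      · have : (Y₂ ∘L Y₁).det = Y₂.det * Y₁.det := by
          simp [ContinuousLinearMap.det, LinearMap.det_comp]
        rw [this, d1, d2, one_mul]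
  have := iter n x hx
  rwa [mul_div_cancel₀ _ hn0.ne'] at this

end PlanarFlow

/-! ### Hamiltonian flow in a confining potential and Liouville's theorem. -/

section Confined

open scoped NNReal ContDiff

/-- The phase space of one degree of freedom with position in `(-a, a)`. -/
def strip (a : ℝ) : Set (ℝ × ℝ) := Ioo (-a) a ×ˢ univ

theorem mem_strip {a : ℝ} {x : ℝ × ℝ} : x ∈ strip a ↔ x.1 ∈ Ioo (-a) a := by simp [strip]

theorem isOpen_strip (a : ℝ) : IsOpen (strip a) := isOpen_Ioo.prod isOpen_univ

/-- A smooth potential on `(-a, a)`, bounded below and tending to infinity at both ends. -/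
structure ConfiningPotential (a : ℝ) (U : ℝ → ℝ) : Prop where
  contDiffOn : ContDiffOn ℝ ∞ U (Ioo (-a) a)
  bddBelow : ∃ m, ∀ z ∈ Ioo (-a) a, m ≤ U z
  coercive : ∀ E, ∃ ε > 0, ∀ z ∈ Ioo (-a) a, U z ≤ E → z ∈ Icc (-a + ε) (a - ε)

/-- The energy of one degree of freedom with potential `U`. -/
noncomputable def energy (U : ℝ → ℝ) (x : ℝ × ℝ) : ℝ := x.2 ^ 2 / 2 + U x.1

/-- The Hamiltonian vector field of `energy U`. -/
noncomputable def hamiltonianField (U : ℝ → ℝ) (x : ℝ × ℝ) : ℝ × ℝ := (x.2, -deriv U x.1)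

namespace ConfiningPotential

variable {a : ℝ} {U : ℝ → ℝ}

theorem contDiffAt (hU : ConfiningPotential a U) {z : ℝ} (hz : z ∈ Ioo (-a) a) :
    ContDiffAt ℝ ∞ U z := hU.contDiffOn.contDiffAt (isOpen_Ioo.mem_nhds hz)

theorem contDiffAt_deriv (hU : ConfiningPotential a U) {z : ℝ} (hz : z ∈ Ioo (-a) a) :
    ContDiffAt ℝ ∞ (deriv U) z :=
  (hU.contDiffOn.deriv_of_isOpen isOpen_Ioo (by simp)).contDiffAt (isOpen_Ioo.mem_nhds hz)

theorem contDiffAt_energy (hU : ConfiningPotential a U) {x : ℝ × ℝ} (hx : x ∈ strip a) :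
    ContDiffAt ℝ ∞ (energy U) x :=
  ((contDiffAt_snd.pow 2).div_const 2).add
    ((hU.contDiffAt (mem_strip.1 hx)).comp x contDiffAt_fst)

theorem continuousOn_energy (hU : ConfiningPotential a U) : ContinuousOn (energy U) (strip a) :=
  fun _ hx => (hU.contDiffAt_energy hx).continuousAt.continuousWithinAt

theorem contDiffAt_field (hU : ConfiningPotential a U) {x : ℝ × ℝ} (hx : x ∈ strip a) :
    ContDiffAt ℝ ∞ (hamiltonianField U) x :=
  contDiffAt_snd.prodMk ((hU.contDiffAt_deriv (mem_strip.1 hx)).comp x contDiffAt_fst).neg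

theorem hasDerivAt (hU : ConfiningPotential a U) {z : ℝ} (hz : z ∈ Ioo (-a) a) :
    HasDerivAt U (deriv U z) z :=
  ((hU.contDiffAt hz).differentiableAt (by simp)).hasDerivAt

theorem isCompact_sublevel (hU : ConfiningPotential a U) (E : ℝ) :
    IsCompact {x ∈ strip a | energy U x ≤ E} := by
  obtain ⟨m, hm⟩ := hU.bddBelow
  obtain ⟨ε, hε, hεU⟩ := hU.coercive E
  -- The momentum bound uses `|p| ≤ p ^ 2 + 1` in place of a square root.
  set Q : Set (ℝ × ℝ) := Icc (-a + ε) (a - ε) ×ˢ Icc (-(2 * (E - m) + 1)) (2 * (E - m) + 1)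
  have hQ : IsCompact Q := isCompact_Icc.prod isCompact_Icc
  have hQs : Q ⊆ strip a := fun x hx =>
    mem_strip.2 ⟨by linarith [hx.1.1], by linarith [hx.1.2]⟩
  have e : {x ∈ strip a | energy U x ≤ E} = Q ∩ energy U ⁻¹' Iic E := by
    ext x
    refine ⟨fun hx => ⟨⟨?_, ?_⟩, hx.2⟩, fun hx => ⟨hQs hx.1, hx.2⟩⟩
    · refine hεU _ (mem_strip.1 hx.1) ?_
      have := hx.2
      unfold energy at this
      nlinarith [sq_nonneg x.2]
    · have h1 := hm _ (mem_strip.1 hx.1)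
      have h2 := hx.2
      unfold energy at h2
      constructor <;> nlinarith [sq_nonneg (x.2 - 1), sq_nonneg (x.2 + 1)]
  rw [e]
  exact hQ.of_isClosed_subset
    ((hU.continuousOn_energy.mono hQs).preimage_isClosed_of_isClosed hQ.isClosed isClosed_Iic)
    inter_subset_left

end ConfiningPotential

open Classical in
/-- The Hamiltonian field, cut off smoothly above the energy `n`. -/
noncomputable def cutoffField (a : ℝ) (U : ℝ → ℝ) (n : ℝ) (x : ℝ × ℝ) : ℝ × ℝ :=
  if x ∈ strip a then Real.smoothTransition (n + 1 - energy U x) • hamiltonianField U x else 0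

namespace ConfiningPotential

variable {a : ℝ} {U : ℝ → ℝ}

theorem cutoffField_eq_zero {n : ℝ} {x : ℝ × ℝ} (hx : x ∉ {x ∈ strip a | energy U x ≤ n + 1}) :
    cutoffField a U n x = 0 := by
  unfold cutoffField
  split_ifs with h
  · rw [Real.smoothTransition.zero_of_nonpos, zero_smul]
    have : ¬ energy U x ≤ n + 1 := fun h' => hx ⟨h, h'⟩
    linarith
  · rfl

theorem cutoffField_eq {n : ℝ} {x : ℝ × ℝ} (hx : x ∈ strip a) (hn : energy U x ≤ n) :
    cutoffField a U n x = hamiltonianField U x := by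
  rw [cutoffField, if_pos hx, Real.smoothTransition.one_of_one_le (by linarith), one_smul]

theorem contDiff_cutoffField (hU : ConfiningPotential a U) (n : ℝ) :
    ContDiff ℝ ∞ (cutoffField a U n) := by
  rw [contDiff_iff_contDiffAt]
  intro x
  by_cases hx : x ∈ strip a
  · have h1 : ContDiffAt ℝ ∞
        (fun x => Real.smoothTransition (n + 1 - energy U x) • hamiltonianField U x) x := by
      refine ContDiffAt.smul (𝕜' := ℝ) ?_ (hU.contDiffAt_field hx)
      exact Real.smoothTransition.contDiffAt.comp x (contDiffAt_const.sub (hU.contDiffAt_energy hx))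
    refine h1.congr_of_eventuallyEq ?_
    filter_upwards [(isOpen_strip a).mem_nhds hx] with y hy
    rw [cutoffField, if_pos hy]
  -- The field vanishes off a compact subset of the strip, hence near every point outside the strip,
  -- including its boundary.
  · have h1 : {x ∈ strip a | energy U x ≤ n + 1}ᶜ ∈ 𝓝 x :=
      (hU.isCompact_sublevel (n + 1)).isClosed.isOpen_compl.mem_nhds fun h => hx h.1
    refine (contDiffAt_const (c := (0 : ℝ × ℝ))).congr_of_eventuallyEq ?_
    filter_upwards [h1] with y hy
    exact cutoffField_eq_zero hy

theorem hasCompactSupport_cutoffField (hU : ConfiningPotential a U) (n : ℝ) :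
    HasCompactSupport (cutoffField a U n) :=
  HasCompactSupport.intro (hU.isCompact_sublevel (n + 1)) fun _ hx => cutoffField_eq_zero hx

/-- The open set of phase points of energy less than `n`. -/
def _root_.lowEnergy (a : ℝ) (U : ℝ → ℝ) (n : ℝ) : Set (ℝ × ℝ) := {x ∈ strip a | energy U x < n}

theorem isOpen_lowEnergy (hU : ConfiningPotential a U) (n : ℝ) : IsOpen (lowEnergy a U n) :=
  hU.continuousOn_energy.isOpen_inter_preimage (isOpen_strip a) isOpen_Iio

theorem hasDerivAt_energy_comp (hU : ConfiningPotential a U) {γ : ℝ → ℝ × ℝ} {k t : ℝ}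
    (hγ : HasDerivAt γ (k • hamiltonianField U (γ t)) t) (ht : γ t ∈ strip a) :
    HasDerivAt (fun s => energy U (γ s)) 0 t := by
  have h1 : HasDerivAt (fun s => (γ s).1) (k * (γ t).2) t := by
    simpa [hamiltonianField] using hγ.prod_fst
  have h2 : HasDerivAt (fun s => (γ s).2) (k * -deriv U (γ t).1) t := by
    simpa [hamiltonianField] using hγ.prod_snd
  have h3 := ((h2.pow 2).div_const 2).add ((hU.hasDerivAt (mem_strip.1 ht)).comp t h1)
  refine h3.congr_deriv ?_
  simp
  ring

/-- A scalar multiple of the Hamiltonian field still conserves energy. The good times form an open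
set by this conservation and a closed one because energy sublevel sets are compact in the strip: the
walls are never reached. -/
theorem cutoff_flow_mem (hU : ConfiningPotential a U) {n : ℝ} {ψ : ℝ → ℝ × ℝ → ℝ × ℝ}
    (hψ : IsFlowOf ψ (cutoffField a U n)) {x : ℝ × ℝ} (hx : x ∈ strip a) (t : ℝ) :
    ψ t x ∈ strip a ∧ energy U (ψ t x) = energy U x := by
  set S : Set ℝ := {t | ψ t x ∈ strip a ∧ energy U (ψ t x) = energy U x}
  have hcont : Continuous fun t => ψ t x :=
    continuous_iff_continuousAt.2 fun t => (hψ.hasDerivAt t x).continuousAt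
  have hcl : IsClosed S := by
    set C := {y ∈ strip a | energy U y ≤ energy U x}
    have hC : IsClosed C := (hU.isCompact_sublevel _).isClosed
    have h1 : IsClosed (C ∩ energy U ⁻¹' Ici (energy U x)) :=
      (hU.continuousOn_energy.mono fun y hy => hy.1).preimage_isClosed_of_isClosed hC isClosed_Ici
    convert h1.preimage hcont using 1
    ext t
    simp only [S, C, mem_ofPred_eq, mem_preimage, mem_inter_iff, mem_Ici, and_assoc]
    refine and_congr_right fun _ => ⟨fun h => ⟨h.le, h.ge⟩, fun h => le_antisymm h.1 h.2⟩
  have hop : IsOpen S := by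
    rw [Metric.isOpen_iff]
    intro t ht
    have h1 : (fun t => ψ t x) ⁻¹' strip a ∈ 𝓝 t :=
      hcont.continuousAt.preimage_mem_nhds ((isOpen_strip a).mem_nhds ht.1)
    obtain ⟨ε, hε, hball⟩ := Metric.mem_nhds_iff.1 h1
    refine ⟨ε, hε, fun s hs => ⟨hball hs, ?_⟩⟩
    have hd : ∀ r ∈ Metric.ball t ε,
        HasDerivWithinAt (fun s => energy U (ψ s x)) 0 (Metric.ball t ε) r := by
      intro r hr
      have h2 := hψ.hasDerivAt r x
      rw [cutoffField, if_pos (show ψ r x ∈ strip a from hball hr)] at h2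
      exact (hU.hasDerivAt_energy_comp h2 (hball hr)).hasDerivWithinAt
    have := (convex_ball t ε).norm_image_sub_le_of_norm_hasDerivWithin_le (C := 0) hd
      (by simp) (Metric.mem_ball_self hε) hs
    rw [← ht.2]
    simpa [sub_eq_zero] using this
  have := IsClopen.eq_univ ⟨hcl, hop⟩ ⟨0, by simp [S, hψ.zero, hx]⟩
  exact (this ▸ mem_univ t : t ∈ S)

theorem fderiv_cutoffField_trace (hU : ConfiningPotential a U) {n : ℝ} {x : ℝ × ℝ}
    (hx : x ∈ lowEnergy a U n) : (fderiv ℝ (cutoffField a U n) x (1, 0)).1 +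
      (fderiv ℝ (cutoffField a U n) x (0, 1)).2 = 0 := by
  have e : cutoffField a U n =ᶠ[𝓝 x] hamiltonianField U := by
    filter_upwards [(hU.isOpen_lowEnergy n).mem_nhds hx] with y hy
    exact cutoffField_eq hy.1 hy.2.le
  have hd : HasDerivAt (deriv U) (deriv (deriv U) x.1) x.1 :=
    ((hU.contDiffAt_deriv (mem_strip.1 hx.1)).differentiableAt (by simp)).hasDerivAt
  have h2 : HasFDerivAt (hamiltonianField U) _ x :=
    (hasFDerivAt_snd (𝕜 := ℝ)).prodMk (hd.hasFDerivAt.comp x (hasFDerivAt_fst (𝕜 := ℝ))).neg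
  rw [e.fderiv_eq, h2.fderiv]
  simp

end ConfiningPotential

/-- `φ` is the flow of `hamiltonianField U` on the strip, together with its basic properties. -/
structure IsConfinedFlow (a : ℝ) (U : ℝ → ℝ) (φ : ℝ → ℝ × ℝ → ℝ × ℝ) : Prop where
  mem : ∀ t, ∀ x ∈ strip a, φ t x ∈ strip a
  zero : ∀ x, φ 0 x = x
  add : ∀ s t, ∀ x ∈ strip a, φ (s + t) x = φ s (φ t x)
  hasDerivAt : ∀ t, ∀ x ∈ strip a, HasDerivAt (fun s => φ s x) (hamiltonianField U (φ t x)) t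
  energy_eq : ∀ t, ∀ x ∈ strip a, energy U (φ t x) = energy U x
  differentiableAt : ∀ t, ∀ x ∈ strip a,
    DifferentiableAt ℝ (fun y : ℝ × (ℝ × ℝ) => φ y.1 y.2) (t, x)
  det_fderiv : ∀ t, ∀ x ∈ strip a, (fderiv ℝ (φ t) x).det = 1

/-- The cut-off fields are smooth with compact support, so they have global flows. Below the energy
`n` the `n`-th field is the true one and its flow stays there by energy conservation, so the flows
agree and glue together. -/
theorem ConfiningPotential.exists_isConfinedFlow {a : ℝ} {U : ℝ → ℝ}
    (hU : ConfiningPotential a U) : ∃ φ, IsConfinedFlow a U φ := by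
  have hlip : ∀ n : ℕ, ∃ K, LipschitzWith K (cutoffField a U n) := fun n =>
    (hU.contDiff_cutoffField n).lipschitzWith_of_hasCompactSupport
      (hU.hasCompactSupport_cutoffField n) (by simp)
  have hlip' : ∀ n : ℕ, ∃ K, LipschitzWith K (fderiv ℝ (cutoffField a U n)) := fun n =>
    ((hU.contDiff_cutoffField n).fderiv_right (m := ∞) (by simp)).lipschitzWith_of_hasCompactSupport
      ((hU.hasCompactSupport_cutoffField n).fderiv ℝ) (by simp)
  have hbdd : ∀ n : ℕ, ∃ M : ℝ≥0, ∀ x, ‖cutoffField a U n x‖ ≤ M := by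
    intro n
    obtain ⟨C, hC⟩ := (hU.hasCompactSupport_cutoffField n).exists_bound_of_continuous
      (hU.contDiff_cutoffField n).continuous
    exact ⟨⟨max C 0, le_max_right _ _⟩, fun x => (hC x).trans (le_max_left _ _)⟩
  choose K hK using hlip
  choose K' hK' using hlip'
  choose M hM using hbdd
  choose ψ hψ using fun n => exists_isFlowOf (hK n) (hM n)
  have hder : ∀ n : ℕ, ∀ x, HasFDerivAt (cutoffField a U n) (fderiv ℝ (cutoffField a U n) x) x :=
    fun n x => ((hU.contDiff_cutoffField n).differentiable (by simp) x).hasFDerivAt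
  have hlow : ∀ n : ℕ, ∀ t, ∀ x ∈ lowEnergy a U n, ψ n t x ∈ lowEnergy a U n := by
    intro n t x hx
    obtain ⟨h1, h2⟩ := hU.cutoff_flow_mem (hψ n) hx.1 t
    exact ⟨h1, h2 ▸ hx.2⟩
  have hdet : ∀ n : ℕ, ∀ t, ∀ x ∈ lowEnergy a U n,
      ∃ Y : ℝ × ℝ →L[ℝ] ℝ × ℝ, HasFDerivAt (ψ n t) Y x ∧ Y.det = 1 := by
    intro n t x hx
    rcases le_total 0 t with ht | ht
    · exact (hψ n).exists_hasFDerivAt_det_eq_one (hK n) (hder n) (hK' n) (hlow n)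
        (fun x hx => hU.fderiv_cutoffField_trace hx) ht hx
    -- Negative times are positive times of the reversed field.
    · have := (hψ n).neg.exists_hasFDerivAt_det_eq_one (hK n).neg (fun x => (hder n x).neg)
        (hK' n).neg (fun t x hx => hlow n (-t) x hx)
        (fun x hx => by
          have := hU.fderiv_cutoffField_trace hx
          simp only [neg_apply, Prod.fst_neg, Prod.snd_neg]
          linarith) (neg_nonneg.2 ht) hx
      simpa using this
  have agree : ∀ n m : ℕ, n ≤ m → ∀ t, ∀ x ∈ lowEnergy a U n, ψ n t x = ψ m t x := by
    intro n m hnm t x hx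
    have hnm' : (n : ℝ) ≤ m := by exact_mod_cast hnm
    refine congrFun (integralCurve_unique (hK m) (f := fun t => ψ n t x) (fun s => ?_)
      (fun s => (hψ m).hasDerivAt s x) (t₀ := 0) (by simp [(hψ _).zero])) t
    have h1 := (hψ n).hasDerivAt s x
    have h2 := hlow n s x hx
    rw [ConfiningPotential.cutoffField_eq h2.1 h2.2.le] at h1
    rwa [ConfiningPotential.cutoffField_eq h2.1 (h2.2.le.trans hnm')]
  -- The `+ 1` makes the energy strictly smaller than `N x`, so that `N x` also serves all points
  -- near `x`.
  set N : ℝ × ℝ → ℕ := fun x => ⌈energy U x⌉₊ + 1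
  have hN : ∀ x ∈ strip a, x ∈ lowEnergy a U (N x) := fun x hx =>
    ⟨hx, by simp only [N]; push_cast; linarith [Nat.le_ceil (energy U x)]⟩
  have heq : ∀ n : ℕ, ∀ t, ∀ x ∈ lowEnergy a U n, ψ (N x) t x = ψ n t x := by
    intro n t x hx
    rcases le_total (N x) n with h | h
    · exact agree _ _ h t x (hN x hx.1)
    · exact (agree _ _ h t x hx).symm
  have hnear : ∀ x ∈ strip a, ∀ᶠ y in 𝓝 x, ∀ t, ψ (N y) t y = ψ (N x) t y := fun x hx => by
    filter_upwards [(hU.isOpen_lowEnergy (N x)).mem_nhds (hN x hx)] with y hy t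
    exact heq _ t y hy
  refine ⟨fun t x => ψ (N x) t x, ⟨?_, ?_, ?_, ?_, ?_, ?_, ?_⟩⟩
  · exact fun t x hx => (hlow _ t x (hN x hx)).1
  · exact fun x => (hψ _).zero x
  · intro s t x hx
    rw [(hψ _).add (hK _), heq _ s _ (hlow _ t x (hN x hx))]
  · intro t x hx
    have h1 := (hψ (N x)).hasDerivAt t x
    have h2 := hlow _ t x (hN x hx)
    rwa [ConfiningPotential.cutoffField_eq h2.1 h2.2.le] at h1
  · exact fun t x hx => (hU.cutoff_flow_mem (hψ _) hx t).2
  · intro t x hx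
    obtain ⟨Y, hY, -⟩ := hdet _ t x (hN x hx)
    refine ((hψ (N x)).differentiableAt_uncurry (hK _) (hM _)
    hY.differentiableAt).congr_of_eventuallyEq
      ?_
    have := (continuous_snd.tendsto ((t, x) : ℝ × (ℝ × ℝ))).eventually (hnear x hx)
    exact this.mono fun y hy => hy y.1
  · intro t x hx
    obtain ⟨Y, hY, hYd⟩ := hdet _ t x (hN x hx)
    have : (fun y => ψ (N y) t y) =ᶠ[𝓝 x] ψ (N x) t := (hnear x hx).mono fun y hy => hy t
    rw [Filter.EventuallyEq.fderiv_eq this, hY.fderiv, hYd]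

namespace IsConfinedFlow

variable {a : ℝ} {U : ℝ → ℝ} {φ : ℝ → ℝ × ℝ → ℝ × ℝ}

theorem neg_apply_apply (hφ : IsConfinedFlow a U φ) (t : ℝ) {x : ℝ × ℝ} (hx : x ∈ strip a) :
    φ (-t) (φ t x) = x := by
  rw [← hφ.add _ _ x hx, neg_add_cancel, hφ.zero]

theorem apply_neg_apply (hφ : IsConfinedFlow a U φ) (t : ℝ) {x : ℝ × ℝ} (hx : x ∈ strip a) :
    φ t (φ (-t) x) = x := by
  rw [← hφ.add _ _ x hx, add_neg_cancel, hφ.zero]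

theorem image_strip (hφ : IsConfinedFlow a U φ) (t : ℝ) : φ t '' strip a = strip a :=
  Subset.antisymm (image_subset_iff.2 (hφ.mem t)) fun x hx =>
    ⟨φ (-t) x, hφ.mem _ x hx, hφ.apply_neg_apply t hx⟩

theorem injOn (hφ : IsConfinedFlow a U φ) (t : ℝ) : InjOn (φ t) (strip a) :=
  fun x hx y hy h => by rw [← hφ.neg_apply_apply t hx, h, hφ.neg_apply_apply t hy]

theorem hasFDerivAt (hφ : IsConfinedFlow a U φ) (t : ℝ) {x : ℝ × ℝ} (hx : x ∈ strip a) :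
    HasFDerivAt (φ t) (fderiv ℝ (φ t) x) x := by
  have h := hφ.differentiableAt t x hx
  have : DifferentiableAt ℝ (φ t) x :=
    DifferentiableAt.comp (𝕜 := ℝ) x (f := fun y => (t, y)) (g := fun y : ℝ × (ℝ × ℝ) => φ y.1 y.2)
      h (differentiableAt_const t |>.prodMk differentiableAt_id)
  exact this.hasFDerivAt

theorem continuousOn_uncurry (hφ : IsConfinedFlow a U φ) :
    ContinuousOn (fun y : ℝ × (ℝ × ℝ) => φ y.1 y.2) (univ ×ˢ strip a) :=
  fun y hy => (hφ.differentiableAt y.1 y.2 hy.2).continuousAt.continuousWithinAt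

theorem continuousOn (hφ : IsConfinedFlow a U φ) (t : ℝ) : ContinuousOn (φ t) (strip a) :=
  fun _ hx => (hφ.hasFDerivAt t hx).continuousAt.continuousWithinAt

/-- Liouville's theorem. -/
theorem lintegral_comp (hφ : IsConfinedFlow a U φ) (t : ℝ) (f : ℝ × ℝ → ENNReal) :
    ∫⁻ x in strip a, f (φ t x) = ∫⁻ x in strip a, f x := by
  have := lintegral_image_eq_lintegral_abs_det_fderiv_mul volume (isOpen_strip a).measurableSet
    (fun x hx => (hφ.hasFDerivAt t hx).hasFDerivWithinAt) (hφ.injOn t) f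
  rw [hφ.image_strip] at this
  rw [this]
  refine setLIntegral_congr_fun (isOpen_strip a).measurableSet fun x hx => ?_
  simp [hφ.det_fderiv t x hx]

theorem integral_comp (hφ : IsConfinedFlow a U φ) (t : ℝ) (f : ℝ × ℝ → ℝ) :
    ∫ x in strip a, f (φ t x) = ∫ x in strip a, f x := by
  have := integral_image_eq_integral_abs_det_fderiv_smul volume (isOpen_strip a).measurableSet
    (fun x hx => (hφ.hasFDerivAt t hx).hasFDerivWithinAt) (hφ.injOn t) f
  rw [hφ.image_strip] at this
  rw [this]
  refine setIntegral_congr_fun (isOpen_strip a).measurableSet fun x hx => ?_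
  simp [hφ.det_fderiv t x hx]

end IsConfinedFlow

end Confined

/-! ### Mean momentum of one particle and its derivative in time. -/

section OneParticle

variable {a : ℝ} {U : ℝ → ℝ} {φ : ℝ → ℝ × ℝ → ℝ × ℝ} {β : ℝ}

theorem restrict_strip (a : ℝ) : (volume : Measure (ℝ × ℝ)).restrict (strip a) =
    ((volume : Measure ℝ).restrict (Ioo (-a) a)).prod volume := by
  rw [strip, Measure.volume_eq_prod, ← Measure.prod_restrict, Measure.restrict_univ]

theorem integral_strip_mul (a : ℝ) (f g : ℝ → ℝ) :
    ∫ x in strip a, f x.1 * g x.2 = (∫ z in Ioo (-a) a, f z) * ∫ p, g p := by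
  rw [restrict_strip, integral_prod_mul]

theorem integrableOn_strip_mul {f g : ℝ → ℝ} (hf : IntegrableOn f (Ioo (-a) a))
    (hg : Integrable g) : IntegrableOn (fun x : ℝ × ℝ => f x.1 * g x.2) (strip a) := by
  rw [IntegrableOn, restrict_strip]
  exact Integrable.mul_prod hf hg

theorem integrableOn_strip_of_bound {f : ℝ × ℝ → ℝ} (hf : ContinuousOn f (strip a)) {b : ℝ}
    (hb : 0 < b) {C : ℝ} (hC : ∀ x ∈ strip a, |f x| ≤ C * Real.exp (-b * x.2 ^ 2)) :
    IntegrableOn f (strip a) := by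
  have h1 : IntegrableOn (fun x : ℝ × ℝ => C * Real.exp (-b * x.2 ^ 2)) (strip a) := by
    have h := integrableOn_strip_mul (a := a) (f := fun _ => C)
      (g := fun p => Real.exp (-b * p ^ 2)) (by simp) (integrable_exp_neg_mul_sq hb)
    exact h
  refine Integrable.mono' h1 (hf.aestronglyMeasurable (isOpen_strip a).measurableSet) ?_
  exact (ae_restrict_iff' (isOpen_strip a).measurableSet).2 (Eventually.of_forall hC)

/-- Supplies a dominating function uniform in time: `y` will be an evolved position of `x`, on the
same energy level. Both squared momenta are at most twice the energy above `m`; half of the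
exponential absorbs them and the other half leaves the Gaussian. -/
theorem ConfiningPotential.exists_gaussian_bound (hU : ConfiningPotential a U) (hβ : 0 < β)
    (h : ℝ) : ∃ C, ∀ x ∈ strip a, ∀ y ∈ strip a, energy U y = energy U x →
      (1 + x.2 ^ 2 + y.2 ^ 2) * Real.exp (-β * (energy U x + h * y.1)) ≤
        C * Real.exp (-(β / 4) * x.2 ^ 2) := by
  obtain ⟨m, hm⟩ := hU.bddBelow
  refine ⟨(1 + 8 / β) * Real.exp (-β * m + β * (|h| * a)), fun x hx y hy hxy => ?_⟩
  have hxm := hm _ (mem_strip.1 hx)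
  have hym := hm _ (mem_strip.1 hy)
  set e := energy U x - m with he
  have hx2 : x.2 ^ 2 ≤ 2 * e := by rw [he, energy]; linarith
  have hy2 : y.2 ^ 2 ≤ 2 * e := by rw [he, ← hxy, energy]; linarith
  have h1 : -(h * y.1) ≤ |h| * a := by
    have : |y.1| ≤ a := abs_le.2 ⟨(mem_strip.1 hy).1.le, (mem_strip.1 hy).2.le⟩
    calc -(h * y.1) ≤ |h * y.1| := neg_le_abs _
      _ = |h| * |y.1| := abs_mul _ _
      _ ≤ |h| * a := by gcongr
  have h2 : 1 + x.2 ^ 2 + y.2 ^ 2 ≤ (1 + 8 / β) * Real.exp (β * e / 2) := by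
    have h3 : β * e / 2 + 1 ≤ Real.exp (β * e / 2) := Real.add_one_le_exp _
    have he0 : 0 ≤ e := by nlinarith [sq_nonneg x.2]
    have h4 : 4 * e ≤ 8 / β * Real.exp (β * e / 2) := by
      rw [div_mul_eq_mul_div, le_div_iff₀ hβ]; nlinarith
    have : 1 ≤ Real.exp (β * e / 2) := Real.one_le_exp (by positivity)
    linarith
  calc (1 + x.2 ^ 2 + y.2 ^ 2) * Real.exp (-β * (energy U x + h * y.1))
      ≤ ((1 + 8 / β) * Real.exp (β * e / 2)) *
        Real.exp (-β * m + β * (|h| * a) - β * e) := by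
        gcongr
        rw [he]
        nlinarith
    _ = (1 + 8 / β) * Real.exp (-β * m + β * (|h| * a)) * Real.exp (-(β * e / 2)) := by
        rw [mul_assoc, mul_assoc, ← Real.exp_add, ← Real.exp_add]; ring_nf
    _ ≤ _ := by
        gcongr
        nlinarith

namespace IsConfinedFlow

theorem continuousOn_evolvedWeight (hU : ConfiningPotential a U) (hφ : IsConfinedFlow a U φ)
    (β h t : ℝ) : ContinuousOn
      (fun x => Real.exp (-β * (energy U x + h * (φ (-t) x).1))) (strip a) :=
  Real.continuous_exp.comp_continuousOn (continuousOn_const.mul (hU.continuousOn_energy.add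
    (continuousOn_const.mul (continuous_fst.comp_continuousOn (hφ.continuousOn (-t))))))

theorem integrableOn_evolved (hU : ConfiningPotential a U) (hφ : IsConfinedFlow a U φ)
    (hβ : 0 < β) (h t : ℝ) {g : ℝ × ℝ → ℝ} (hg : ContinuousOn g (strip a))
    (hb : ∀ x ∈ strip a, |g x| ≤ 1 + x.2 ^ 2 + (φ (-t) x).2 ^ 2) : IntegrableOn
      (fun x => g x * Real.exp (-β * (energy U x + h * (φ (-t) x).1))) (strip a) := by
  obtain ⟨C, hC⟩ := hU.exists_gaussian_bound hβ h
  refine integrableOn_strip_of_bound (hg.mul (hφ.continuousOn_evolvedWeight hU β h t))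
    (by positivity : 0 < β / 4) (C := C) fun x hx => ?_
  rw [abs_mul, Real.abs_exp]
  exact (mul_le_mul_of_nonneg_right (hb x hx) (Real.exp_nonneg _)).trans
    (hC x hx _ (hφ.mem _ x hx) (hφ.energy_eq _ x hx))

theorem hasDerivAt_neg (hφ : IsConfinedFlow a U φ) (t : ℝ) {x : ℝ × ℝ} (hx : x ∈ strip a) :
    HasDerivAt (fun s => φ (-s) x) (-hamiltonianField U (φ (-t) x)) t := by
  simpa [Function.comp_def] using (hφ.hasDerivAt (-t) x hx).scomp t (_root_.hasDerivAt_neg t)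

theorem abs_mul_le (x y : ℝ) : |x * y| ≤ 1 + x ^ 2 + y ^ 2 := by
  rw [abs_le]; constructor <;> nlinarith [sq_nonneg (x - y), sq_nonneg (x + y)]

/-- The derivative of the mean momentum after the perturbation `-h z` is switched on. -/
theorem hasDerivAt_meanMomentum (hU : ConfiningPotential a U) (hφ : IsConfinedFlow a U φ)
    (hβ : 0 < β) (h t : ℝ) : HasDerivAt
      (fun t => ∫ x in strip a, x.2 * Real.exp (-β * (energy U x + h * (φ (-t) x).1)))
      (β * h * ∫ x in strip a,
        x.2 * (φ (-t) x).2 * Real.exp (-β * (energy U x + h * (φ (-t) x).1))) t := by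
  obtain ⟨C, hC⟩ := hU.exists_gaussian_bound hβ h
  have hms := (isOpen_strip a).measurableSet
  rw [← integral_const_mul]
  refine (hasDerivAt_integral_of_dominated_loc_of_deriv_le (μ := volume.restrict (strip a))
    (F := fun t x => x.2 * Real.exp (-β * (energy U x + h * (φ (-t) x).1)))
    (F' := fun t x => β * h *
      (x.2 * (φ (-t) x).2 * Real.exp (-β * (energy U x + h * (φ (-t) x).1))))
    (bound := fun x => |β * h| * (C * Real.exp (-(β / 4) * x.2 ^ 2))) (s := univ)
    univ_mem ?_ ?_ ?_ ?_ ?_ ?_).2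
  · exact Eventually.of_forall fun s => (continuousOn_snd.mul
      (hφ.continuousOn_evolvedWeight hU β h s)).aestronglyMeasurable hms
  · refine hφ.integrableOn_evolved hU hβ h t continuousOn_snd fun x _ => ?_
    rw [abs_le]
    constructor <;> nlinarith [sq_nonneg (x.2 - 1), sq_nonneg (x.2 + 1), sq_nonneg (φ (-t) x).2]
  · exact (continuousOn_const.mul ((continuousOn_snd.mul
      (continuous_snd.comp_continuousOn (hφ.continuousOn (-t)))).mul
      (hφ.continuousOn_evolvedWeight hU β h t))).aestronglyMeasurable hms
  · refine (ae_restrict_iff' hms).2 (Eventually.of_forall fun x hx s _ => ?_)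
    rw [Real.norm_eq_abs, abs_mul, abs_mul _ (Real.exp _), Real.abs_exp]
    refine mul_le_mul_of_nonneg_left ?_ (abs_nonneg _)
    refine (mul_le_mul_of_nonneg_right (abs_mul_le x.2 (φ (-s) x).2) (Real.exp_nonneg _)).trans ?_
    exact hC x hx _ (hφ.mem _ x hx) (hφ.energy_eq _ x hx)
  · exact (integrableOn_strip_mul (a := a) (f := fun _ => C)
      (g := fun p => Real.exp (-(β / 4) * p ^ 2)) (by simp)
      (integrable_exp_neg_mul_sq (by positivity))).const_mul |β * h|
  · refine (ae_restrict_iff' hms).2 (Eventually.of_forall fun x hx s _ => ?_)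
    -- The position at time `-s` has derivative minus the momentum at time `-s`; with the factor `-β
    -- * h` of the exponent this gives the sign of the result.
    have h1 := (hφ.hasDerivAt_neg s hx).prod_fst
    have h2 := ((((h1.const_mul h).const_add (energy U x)).const_mul (-β)).exp).const_mul x.2
    refine h2.congr_deriv ?_
    simp [hamiltonianField]
    ring

/-- Cauchy-Schwarz against the constant function, obtained by expanding the nonnegative integral of
`(t * f - I) ^ 2`. -/
theorem sq_integral_le {f : ℝ → ℝ} (hf : Continuous f) {t : ℝ} (ht : 0 ≤ t) :
    (∫ s in (0 : ℝ)..t, f s) ^ 2 ≤ t * ∫ s in (0 : ℝ)..t, f s ^ 2 := by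
  rcases ht.eq_or_lt with rfl | ht
  · simp
  set I := ∫ s in (0 : ℝ)..t, f s with hI
  have h0 : 0 ≤ ∫ s in (0 : ℝ)..t, (t * f s - I) ^ 2 :=
    intervalIntegral.integral_nonneg ht.le fun _ _ => sq_nonneg _
  have e : ∫ s in (0 : ℝ)..t, (t * f s - I) ^ 2 =
      t * (t * (∫ s in (0 : ℝ)..t, f s ^ 2) - I ^ 2) := by
    have h1 : ∀ s, (t * f s - I) ^ 2 = t ^ 2 * f s ^ 2 - 2 * t * I * f s + I ^ 2 := fun s => by ring
    have i1 : IntervalIntegrable (fun s => t ^ 2 * f s ^ 2) volume 0 t :=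
      (continuous_const.mul (hf.pow 2)).intervalIntegrable _ _
    have i2 : IntervalIntegrable (fun s => 2 * t * I * f s) volume 0 t :=
      (continuous_const.mul hf).intervalIntegrable _ _
    simp only [h1]
    rw [intervalIntegral.integral_add (i1.sub i2) (by simp), intervalIntegral.integral_sub i1 i2,
      intervalIntegral.integral_const_mul, intervalIntegral.integral_const_mul,
      intervalIntegral.integral_const, ← hI]
    simp
    ring
  rw [e] at h0
  have := (mul_nonneg_iff_of_pos_left ht).1 h0
  linarith

/-- The change of momentum in time `t` is bounded in mean square by `t` times the force. -/
theorem integral_sq_sub_le (hU : ConfiningPotential a U) (hφ : IsConfinedFlow a U φ)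
    (hint : IntegrableOn (fun x => deriv U x.1 ^ 2 * Real.exp (-β * energy U x)) (strip a))
    {t : ℝ} (ht : 0 ≤ t) :
    ∫ x in strip a, (x.2 - (φ (-t) x).2) ^ 2 * Real.exp (-β * energy U x) ≤
      t ^ 2 * ∫ x in strip a, deriv U x.1 ^ 2 * Real.exp (-β * energy U x) := by
  have hms := (isOpen_strip a).measurableSet
  set F : ℝ × ℝ → ENNReal :=
    fun x => ENNReal.ofReal (deriv U x.1 ^ 2 * Real.exp (-β * energy U x)) with hF
  have hcw : ContinuousOn (fun x => Real.exp (-β * energy U x)) (strip a) :=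
    Real.continuous_exp.comp_continuousOn (continuousOn_const.mul hU.continuousOn_energy)
  have hcU : ContinuousOn (fun x : ℝ × ℝ => deriv U x.1) (strip a) := fun x hx =>
    ((hU.contDiffAt_deriv (mem_strip.1 hx)).continuousAt.comp
      continuous_fst.continuousAt).continuousWithinAt
  have hFc : ContinuousOn F (strip a) :=
    ENNReal.continuous_ofReal.comp_continuousOn ((hcU.pow 2).mul hcw)
  -- The momentum change is the time integral of the force. After Cauchy-Schwarz, energy
  -- conservation lets the weight be evaluated at the moving point.
  have point : ∀ x ∈ strip a,
      ENNReal.ofReal ((x.2 - (φ (-t) x).2) ^ 2 * Real.exp (-β * energy U x)) ≤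
        ENNReal.ofReal t * ∫⁻ s in Ioc 0 t, F (φ (-s) x) := by
    intro x hx
    have hcφ : Continuous fun s => φ (-s) x :=
      continuous_iff_continuousAt.2 fun s => (hφ.hasDerivAt_neg s hx).continuousAt
    have hcd : Continuous fun s => deriv U (φ (-s) x).1 :=
      hcU.comp_continuous hcφ fun s => hφ.mem _ x hx
    have h1 : ∫ s in (0 : ℝ)..t, deriv U (φ (-s) x).1 = (φ (-t) x).2 - x.2 := by
      have := intervalIntegral.integral_eq_sub_of_hasDerivAt (a := 0) (b := t)
        (f := fun s => (φ (-s) x).2) (f' := fun s => deriv U (φ (-s) x).1)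
        (fun s _ => by simpa [hamiltonianField] using (hφ.hasDerivAt_neg s hx).prod_snd)
        (hcd.intervalIntegrable _ _)
      simpa [hφ.zero] using this
    have h2 := sq_integral_le hcd ht
    rw [h1] at h2
    have h3 : ∫⁻ s in Ioc 0 t, F (φ (-s) x) =
        ENNReal.ofReal ((∫ s in (0 : ℝ)..t, deriv U (φ (-s) x).1 ^ 2) *
          Real.exp (-β * energy U x)) := by
      rw [← intervalIntegral.integral_mul_const, intervalIntegral.integral_of_le ht,
        ofReal_integral_eq_lintegral_ofReal]
      · refine lintegral_congr fun s => ?_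
        simp only [hF, hφ.energy_eq _ x hx]
      · exact (((hcd.pow 2).mul continuous_const).intervalIntegrable 0 t).1
      · exact Eventually.of_forall fun s => by positivity
    rw [h3, ← ENNReal.ofReal_mul ht]
    refine ENNReal.ofReal_le_ofReal ?_
    rw [← mul_assoc]
    refine mul_le_mul_of_nonneg_right ?_ (Real.exp_nonneg _)
    linarith [h2, (by ring : ((φ (-t) x).2 - x.2) ^ 2 = (x.2 - (φ (-t) x).2) ^ 2)]
  -- By Tonelli and Liouville's theorem each time `s` contributes the same integral.
  have hswap : ∫⁻ x in strip a, ∫⁻ s in Ioc 0 t, F (φ (-s) x) =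
      ENNReal.ofReal t * ∫⁻ x in strip a, F x := by
    rw [lintegral_lintegral_swap]
    · simp_rw [hφ.lintegral_comp]
      rw [setLIntegral_const, Real.volume_Ioc, sub_zero, mul_comm]
    · have : ContinuousOn (Function.uncurry fun x s => F (φ (-s) x)) (strip a ×ˢ Ioc 0 t) := by
        refine hFc.comp ?_ (fun y hy => hφ.mem _ _ hy.1)
        exact hφ.continuousOn_uncurry.comp (f := fun y : (ℝ × ℝ) × ℝ => (-y.2, y.1))
          (by fun_prop) (fun y hy => ⟨trivial, hy.1⟩)
      rw [Measure.prod_restrict]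
      exact this.aemeasurable (hms.prod measurableSet_Ioc)
  have hl : ∫⁻ x in strip a,
      ENNReal.ofReal ((x.2 - (φ (-t) x).2) ^ 2 * Real.exp (-β * energy U x)) ≤
      ENNReal.ofReal (t ^ 2 * ∫ x in strip a, deriv U x.1 ^ 2 * Real.exp (-β * energy U x)) := by
    calc _ ≤ ∫⁻ x in strip a, ENNReal.ofReal t * ∫⁻ s in Ioc 0 t, F (φ (-s) x) :=
          setLIntegral_mono' hms point
      _ = ENNReal.ofReal t * (ENNReal.ofReal t * ∫⁻ x in strip a, F x) := by
          rw [lintegral_const_mul' _ _ ENNReal.ofReal_ne_top, hswap]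
      _ = _ := by
          rw [hF, ← ofReal_integral_eq_lintegral_ofReal hint
            (Eventually.of_forall fun x => by positivity), ← mul_assoc, ← ENNReal.ofReal_mul ht,
            ← ENNReal.ofReal_mul (by positivity), sq]
  have hnn : 0 ≤ t ^ 2 * ∫ x in strip a, deriv U x.1 ^ 2 * Real.exp (-β * energy U x) :=
    mul_nonneg (sq_nonneg t) (integral_nonneg fun x => by positivity)
  rw [integral_eq_lintegral_of_nonneg_ae (Eventually.of_forall fun x => by positivity)]
  · exact ENNReal.toReal_le_of_le_ofReal hnn hl
  · exact (((continuousOn_snd.sub (continuous_snd.comp_continuousOn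
      (hφ.continuousOn (-t)))).pow 2).mul hcw).aestronglyMeasurable hms

/-- The autocorrelation of the momentum stays positive for short times. -/
theorem integral_momentum_mul_nonneg (hU : ConfiningPotential a U) (hφ : IsConfinedFlow a U φ)
    (hβ : 0 < β) {h : ℝ} (hh : 0 ≤ h)
    (hint : IntegrableOn (fun x => deriv U x.1 ^ 2 * Real.exp (-β * energy U x)) (strip a))
    {t : ℝ} (ht : 0 ≤ t)
    (hle : t ^ 2 / 2 * (∫ x in strip a, deriv U x.1 ^ 2 * Real.exp (-β * energy U x)) ≤
      (2 - Real.exp (β * h * a)) * ∫ x in strip a, x.2 ^ 2 * Real.exp (-β * energy U x)) :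
    0 ≤ ∫ x in strip a,
      x.2 * (φ (-t) x).2 * Real.exp (-β * (energy U x + h * (φ (-t) x).1)) := by
  have hms := (isOpen_strip a).measurableSet
  have hcont : ContinuousOn (fun x => (φ (-t) x).2) (strip a) :=
    continuous_snd.comp_continuousOn (hφ.continuousOn (-t))
  have hI : ∀ {g : ℝ × ℝ → ℝ}, ContinuousOn g (strip a) →
      (∀ x ∈ strip a, |g x| ≤ 1 + x.2 ^ 2 + (φ (-t) x).2 ^ 2) →
      IntegrableOn (fun x => g x * Real.exp (-β * energy U x)) (strip a) := by
    intro g hg hb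
    simpa using hφ.integrableOn_evolved hU hβ 0 t hg hb
  have i1 : IntegrableOn (fun x => x.2 ^ 2 * Real.exp (-β * energy U x)) (strip a) := by
    refine hI (continuousOn_snd.pow 2) fun x _ => ?_
    rw [abs_of_nonneg (sq_nonneg _)]
    linarith [sq_nonneg (φ (-t) x).2]
  have i2 : IntegrableOn (fun x => (φ (-t) x).2 ^ 2 * Real.exp (-β * energy U x)) (strip a) := by
    refine hI (hcont.pow 2) fun x _ => ?_
    rw [abs_of_nonneg (sq_nonneg _)]
    linarith [sq_nonneg x.2]
  have i3' : IntegrableOn (fun x => x.2 * (φ (-t) x).2 * Real.exp (-β * energy U x)) (strip a) :=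
    hI (continuousOn_snd.mul hcont) fun x _ => abs_mul_le _ _
  have i3 : IntegrableOn (fun x => (x.2 - (φ (-t) x).2) ^ 2 * Real.exp (-β * energy U x))
      (strip a) := by
    have := (i1.add i2).sub (i3'.const_mul 2)
    refine this.congr (Eventually.of_forall fun x => ?_)
    simp only [Pi.sub_apply, Pi.add_apply]
    ring
  have i4 := hφ.integrableOn_evolved hU hβ h t (g := fun x => x.2 * (φ (-t) x).2)
    (continuousOn_snd.mul hcont) fun x _ => abs_mul_le _ _
  have einv : ∫ x in strip a, (φ (-t) x).2 ^ 2 * Real.exp (-β * energy U x) =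
      ∫ x in strip a, x.2 ^ 2 * Real.exp (-β * energy U x) := by
    rw [← hφ.integral_comp (-t) fun x => x.2 ^ 2 * Real.exp (-β * energy U x)]
    refine setIntegral_congr_fun hms fun x hx => ?_
    simp only [hφ.energy_eq _ x hx]
  set κ := Real.exp (β * h * a) with hκ
  -- The field multiplies the weight by some `r` with `2 - κ ≤ r ≤ κ`. Writing `p * y * r` as `r / 4
  -- * ((p + y) ^ 2 - (p - y) ^ 2)`, use the lower bound on the first square and the upper bound on
  -- the second.
  have lower : ∫ x in strip a, ((2 - κ) / 2 * (x.2 ^ 2 * Real.exp (-β * energy U x)) +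
      (2 - κ) / 2 * ((φ (-t) x).2 ^ 2 * Real.exp (-β * energy U x)) -
      1 / 2 * ((x.2 - (φ (-t) x).2) ^ 2 * Real.exp (-β * energy U x))) ≤
      ∫ x in strip a, x.2 * (φ (-t) x).2 * Real.exp (-β * (energy U x + h * (φ (-t) x).1)) := by
    refine setIntegral_mono_on (((i1.const_mul _).add (i2.const_mul _)).sub (i3.const_mul _)) i4
      hms fun x hx => ?_
    have hz := mem_strip.1 (hφ.mem (-t) x hx)
    set p := x.2
    set y := φ (-t) x
    have e : Real.exp (-β * (energy U x + h * y.1)) =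
        Real.exp (-β * energy U x) * Real.exp (-β * h * y.1) := by
      rw [← Real.exp_add]; ring_nf
    rw [e]
    have hr1 : Real.exp (-β * h * y.1) ≤ κ := by
      exact Real.exp_le_exp.2 (by nlinarith [mul_nonneg hβ.le hh, hz.1])
    have hr2 : 2 - κ ≤ Real.exp (-β * h * y.1) := by
      have h5 : Real.exp (-(β * h * a)) ≤ Real.exp (-β * h * y.1) := by
        exact Real.exp_le_exp.2 (by nlinarith [mul_nonneg hβ.le hh, hz.2])
      -- This is `cosh ≥ 1`; it replaces the lower bound `κ⁻¹` by one linear in `κ`.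
      have h6 : 2 ≤ κ + Real.exp (-(β * h * a)) := by
        have := Real.one_le_cosh (β * h * a)
        rw [Real.cosh_eq] at this
        linarith
      linarith
    have hkey : (2 - κ) / 2 * p ^ 2 + (2 - κ) / 2 * y.2 ^ 2 - 1 / 2 * (p - y.2) ^ 2 ≤
        p * y.2 * Real.exp (-β * h * y.1) := by
      set r := Real.exp (-β * h * y.1)
      nlinarith [mul_nonneg (sub_nonneg.2 hr1) (sq_nonneg (p - y.2)),
        mul_nonneg (sub_nonneg.2 hr2) (sq_nonneg (p + y.2))]
    have := mul_le_mul_of_nonneg_right hkey (Real.exp_nonneg (-β * energy U x))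
    linarith
  refine le_trans ?_ lower
  have i12 : IntegrableOn (fun x => (2 - κ) / 2 * (x.2 ^ 2 * Real.exp (-β * energy U x)) +
      (2 - κ) / 2 * ((φ (-t) x).2 ^ 2 * Real.exp (-β * energy U x))) (strip a) :=
    (i1.const_mul _).add (i2.const_mul _)
  rw [integral_sub i12 (i3.const_mul _),
    integral_add (i1.const_mul _) (i2.const_mul _), integral_const_mul, integral_const_mul,
    integral_const_mul, einv]
  have := hφ.integral_sq_sub_le hU hint ht
  linarith

end IsConfinedFlow

/-- Equipartition: the derivative of `p * exp (-b * p ^ 2)` has integral zero. -/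
theorem integral_sq_mul_gaussian {b : ℝ} (hb : 0 < b) :
    ∫ p : ℝ, p ^ 2 * Real.exp (-b * p ^ 2) = 1 / (2 * b) * ∫ p : ℝ, Real.exp (-b * p ^ 2) := by
  have i0 := integrable_exp_neg_mul_sq hb
  have i1 : Integrable fun p : ℝ => p * Real.exp (-b * p ^ 2) := integrable_mul_exp_neg_mul_sq hb
  have i2 : Integrable fun p : ℝ => p ^ 2 * Real.exp (-b * p ^ 2) := by
    have := integrable_rpow_mul_exp_neg_mul_sq hb (s := 2) (by norm_num)
    simpa using this
  have hd : ∀ p : ℝ, HasDerivAt (fun p : ℝ => p * Real.exp (-b * p ^ 2))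
      (Real.exp (-b * p ^ 2) - 2 * b * (p ^ 2 * Real.exp (-b * p ^ 2))) p := by
    intro p
    have h := (hasDerivAt_id p).mul (((hasDerivAt_pow 2 p).const_mul (-b)).exp)
    refine h.congr_deriv ?_
    simp
    ring
  have := integral_eq_zero_of_hasDerivAt_of_integrable hd (i0.sub (i2.const_mul (2 * b))) i1
  rw [integral_sub i0 (i2.const_mul _), integral_const_mul] at this
  rw [one_div, eq_inv_mul_iff_mul_eq₀ (by positivity)]
  linarith

end OneParticle

namespace GasInBox

/-! ### The integral of the squared force of one wall. -/

section SingularIntegral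

/-- Dominates the squared force of one wall times its Boltzmann factor. -/
noncomputable def wallKernel (b s : ℝ) : ℝ :=
  (Ioi (0 : ℝ)).indicator (fun s => (1 / s) ^ 26 * Real.exp (-b * (1 / s) ^ 12)) s

theorem wallKernel_of_pos {b s : ℝ} (hs : 0 < s) :
    wallKernel b s = (1 / s) ^ 26 * Real.exp (-b * (1 / s) ^ 12) :=
  indicator_of_mem (mem_Ioi.2 hs) _

theorem wallKernel_nonneg (b s : ℝ) : 0 ≤ wallKernel b s :=
  indicator_nonneg (fun s _ => by positivity) _

/-- The substitution `y = s ^ (-12)`: one factor `s ^ (-13)` comes from the Jacobian, the other from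
`y ^ (13 / 12)`. It turns the wall integral into a Gamma integral. -/
theorem rpow_substitution {b s : ℝ} (hs : s ∈ Ioi (0 : ℝ)) :
    (|(-12 : ℝ)| * s ^ ((-12 : ℝ) - 1)) •
      ((s ^ (-12 : ℝ)) ^ (13 / 12 : ℝ) * Real.exp (-b * s ^ (-12 : ℝ))) =
    12 * ((1 / s) ^ 26 * Real.exp (-b * (1 / s) ^ 12)) := by
  have hs' : 0 < s := hs
  have e1 : s ^ (-12 : ℝ) = (1 / s) ^ 12 := by
    rw [Real.rpow_neg hs'.le, one_div, inv_pow]; norm_cast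
  have e2 : s ^ ((-12 : ℝ) - 1) = (1 / s) ^ 13 := by
    rw [show ((-12 : ℝ) - 1) = -13 by norm_num, Real.rpow_neg hs'.le, one_div, inv_pow]; norm_cast
  have e3 : (s ^ (-12 : ℝ)) ^ (13 / 12 : ℝ) = (1 / s) ^ 13 := by
    rw [← Real.rpow_mul hs'.le, ← e2]; norm_num
  rw [e3, e2, e1, smul_eq_mul, abs_of_neg (by norm_num)]
  ring

theorem integrable_wallKernel {b : ℝ} (hb : 0 < b) : Integrable (wallKernel b) := by
  unfold wallKernel
  rw [integrable_indicator_iff measurableSet_Ioi]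
  have h1 : IntegrableOn (fun y : ℝ => y ^ (13 / 12 : ℝ) * Real.exp (-b * y)) (Ioi 0) := by
    simpa using integrableOn_rpow_mul_exp_neg_mul_rpow (s := 13 / 12) (p := 1) (b := b)
      (by norm_num) one_pos hb
  have h2 := (integrableOn_Ioi_comp_rpow_iff _ (by norm_num : (-12 : ℝ) ≠ 0)).2 h1
  have h3 := (h2.congr_fun (fun s hs => rpow_substitution hs) measurableSet_Ioi).const_mul (1 / 12)
  refine IntegrableOn.congr_fun h3 (fun s _ => ?_) measurableSet_Ioi
  ring

theorem integral_wallKernel {b : ℝ} (hb : 0 < b) :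
    ∫ s, wallKernel b s = 1 / 12 * (b ^ (-(25 / 12) : ℝ) * Real.Gamma (25 / 12)) := by
  unfold wallKernel
  rw [integral_indicator measurableSet_Ioi]
  have h1 := integral_comp_rpow_Ioi
    (fun y : ℝ => y ^ (13 / 12 : ℝ) * Real.exp (-b * y)) (by norm_num : (-12 : ℝ) ≠ 0)
  rw [setIntegral_congr_fun measurableSet_Ioi fun s hs => rpow_substitution hs,
    integral_const_mul] at h1
  have h2 := Real.integral_rpow_mul_exp_neg_mul_Ioi (a := 25 / 12) (r := b) (by norm_num) hb
  rw [one_div, Real.inv_rpow hb.le, ← Real.rpow_neg hb.le] at h2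
  rw [← h2, one_div, eq_inv_mul_iff_mul_eq₀ (by norm_num), h1]
  refine setIntegral_congr_fun measurableSet_Ioi fun s _ => ?_
  norm_num

end SingularIntegral

/-! ### The wall potential, its mean squared force and its normalisation. -/

section WallPotential

variable {β δ L : ℝ}

theorem hasDerivAt_wallPotential {z : ℝ} (hz : z ∈ Ioo (-(L / 2)) (L / 2)) :
    HasDerivAt (wallPotential δ L)
      (-12 * δ * ((1 / (z + L / 2)) ^ 13 + (1 / (z - L / 2)) ^ 13)) z := by
  have h1 : z + L / 2 ≠ 0 := by linarith [hz.1]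
  have h2 : z - L / 2 ≠ 0 := by linarith [hz.2]
  have d1 := (((hasDerivAt_id z).add_const (L / 2)).inv h1).pow 12
  have d2 := (((hasDerivAt_id z).sub_const (L / 2)).inv h2).pow 12
  have := (d1.add d2).const_mul δ
  refine (this.congr_of_eventuallyEq (Eventually.of_forall fun y => ?_)).congr_deriv ?_
  · simp [wallPotential]
  · have e1 : (z + L / 2)⁻¹ ^ 13 = (z + L / 2)⁻¹ ^ 11 * (z + L / 2)⁻¹ ^ 2 := by ring
    have e2 : (z - L / 2)⁻¹ ^ 13 = (z - L / 2)⁻¹ ^ 11 * (z - L / 2)⁻¹ ^ 2 := by ring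
    simp only [one_div, e1, e2, Pi.inv_apply, id]
    simp only [neg_div, one_div, inv_pow]
    push_cast
    generalize ((z + L / 2) ^ 2)⁻¹ = u
    generalize ((z - L / 2) ^ 2)⁻¹ = v
    norm_num
    ring

/-- The potential of one particle in the box and in the external field. -/
noncomputable def tiltedPotential (δ L h z : ℝ) : ℝ := wallPotential δ L z - h * z

theorem hasDerivAt_tiltedPotential {z : ℝ} (h : ℝ) (hz : z ∈ Ioo (-(L / 2)) (L / 2)) :
    HasDerivAt (tiltedPotential δ L h)
      (-12 * δ * ((1 / (z + L / 2)) ^ 13 + (1 / (z - L / 2)) ^ 13) - h) z := by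
  simpa using! (hasDerivAt_wallPotential hz).sub ((hasDerivAt_id z).const_mul h)

theorem wallPotential_nonneg (hδ : 0 ≤ δ) (z : ℝ) : 0 ≤ wallPotential δ L z :=
  mul_nonneg hδ (add_nonneg (Even.pow_nonneg (by decide) _) (Even.pow_nonneg (by decide) _))

theorem wallPotential_eq (z : ℝ) : wallPotential δ L z =
    δ * ((1 / (z + L / 2)) ^ 12 + (1 / (L / 2 - z)) ^ 12) := by
  rw [wallPotential, ← neg_sub (L / 2) z, one_div_neg_eq_neg_one_div, Even.neg_pow (by decide)]

theorem contDiffAt_wallPotential {z : ℝ} (hz : z ∈ Ioo (-(L / 2)) (L / 2)) {n : WithTop ℕ∞} :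
    ContDiffAt ℝ n (wallPotential δ L) z := by
  have h1 : z + L / 2 ≠ 0 := by linarith [hz.1]
  have h2 : z - L / 2 ≠ 0 := by linarith [hz.2]
  unfold wallPotential
  fun_prop (disch := assumption)

/-- A crude distance from the wall suffices for coercivity: for `s ≤ 1` the twelfth power of `1 / s`
dominates `1 / s`, so no twelfth root is taken. -/
theorem le_of_mul_one_div_pow_le {E s : ℝ} (hδ : 0 < δ) (hs : 0 < s) (hE : 0 < E)
    (h : δ * (1 / s) ^ 12 ≤ E) : min 1 (δ / E) ≤ s := by
  rcases le_total 1 s with h1 | h1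
  · exact (min_le_left _ _).trans h1
  · refine (min_le_right _ _).trans ?_
    have h2 : 1 ≤ 1 / s := one_le_one_div hs h1
    have h3 : 1 / s ≤ (1 / s) ^ 12 := le_self_pow₀ h2 (by norm_num)
    have h4 : δ * (1 / s) ≤ E := (mul_le_mul_of_nonneg_left h3 hδ.le).trans h
    rw [div_le_iff₀ hE]
    rw [mul_one_div, div_le_iff₀ hs] at h4
    linarith

theorem abs_mul_le_of_mem {z : ℝ} (h : ℝ) (hz : z ∈ Ioo (-(L / 2)) (L / 2)) :
    |h * z| ≤ |h| * (L / 2) := by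
  rw [abs_mul]
  exact mul_le_mul_of_nonneg_left (abs_le.2 ⟨hz.1.le, hz.2.le⟩) (abs_nonneg _)

theorem confiningPotential_tilted (hδ : 0 < δ) (hL : 0 < L) (h : ℝ) :
    ConfiningPotential (L / 2) (tiltedPotential δ L h) where
  contDiffOn z hz := ((contDiffAt_wallPotential hz).sub
    (contDiffAt_const.mul contDiffAt_id)).contDiffWithinAt
  bddBelow := ⟨-(|h| * (L / 2)), fun z hz => by
    have h1 := (abs_le.1 (abs_mul_le_of_mem h hz)).2
    have h2 := wallPotential_nonneg (L := L) hδ.le z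
    unfold tiltedPotential
    linarith⟩
  coercive E := by
    have hE : 0 < |E| + |h| * (L / 2) + 1 := by positivity
    refine ⟨min 1 (δ / (|E| + |h| * (L / 2) + 1)), by positivity, fun z hz hzE => ?_⟩
    have h1 := (abs_le.1 (abs_mul_le_of_mem h hz)).2
    have h2 := le_abs_self E
    rw [tiltedPotential, wallPotential_eq] at hzE
    have s1 : 0 < z + L / 2 := by linarith [hz.1]
    have s2 : 0 < L / 2 - z := by linarith [hz.2]
    have p1 : 0 < δ * (1 / (z + L / 2)) ^ 12 := by positivity
    have p2 : 0 < δ * (1 / (L / 2 - z)) ^ 12 := by positivity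
    rw [mul_add] at hzE
    have q1 := le_of_mul_one_div_pow_le hδ s1 hE (by linarith)
    have q2 := le_of_mul_one_div_pow_le hδ s2 hE (by linarith)
    exact ⟨by linarith, by linarith⟩

theorem continuousOn_wallPotential : ContinuousOn (wallPotential δ L) (Ioo (-(L / 2)) (L / 2)) :=
  fun _ hz => (contDiffAt_wallPotential (n := 0) hz).continuousAt.continuousWithinAt

theorem continuousOn_deriv_wallPotential :
    ContinuousOn (deriv (wallPotential δ L)) (Ioo (-(L / 2)) (L / 2)) := fun z hz =>
  (((show ContDiffOn ℝ 1 (wallPotential δ L) _ from fun _ hz =>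
    (contDiffAt_wallPotential hz).contDiffWithinAt).continuousOn_deriv_of_isOpen isOpen_Ioo
      (by simp)) z hz)

theorem integrableOn_boltzmann (hβ : 0 < β) (hδ : 0 < δ) :
    IntegrableOn (fun z => Real.exp (-β * wallPotential δ L z)) (Ioo (-(L / 2)) (L / 2)) := by
  refine Integrable.mono' (g := fun _ => (1 : ℝ)) (by simp)
    ((Real.continuous_exp.comp_continuousOn (continuousOn_const.mul
      continuousOn_wallPotential)).aestronglyMeasurable measurableSet_Ioo) ?_
  refine Eventually.of_forall fun z => ?_
  rw [Real.norm_eq_abs, Real.abs_exp, Real.exp_le_one_iff]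
  nlinarith [mul_nonneg hβ.le (wallPotential_nonneg (L := L) hδ.le z)]

/-- The two walls push in opposite directions, so the squared total force is at most that of the
nearer wall alone and there is no cross term. Dropping the other wall from the exponent only
increases the weight. -/
theorem force_sq_mul_boltzmann_le (hβ : 0 < β) (hδ : 0 < δ) {z : ℝ}
    (hz : z ∈ Ioo (-(L / 2)) (L / 2)) :
    deriv (wallPotential δ L) z ^ 2 * Real.exp (-β * wallPotential δ L z) ≤
      144 * δ ^ 2 * (wallKernel (β * δ) (z + L / 2) + wallKernel (β * δ) (L / 2 - z)) := by
  have s1 : 0 < z + L / 2 := by linarith [hz.1]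
  have s2 : 0 < L / 2 - z := by linarith [hz.2]
  rw [(hasDerivAt_wallPotential hz).deriv, wallPotential_eq, wallKernel_of_pos s1,
    wallKernel_of_pos s2, ← neg_sub (L / 2) z, one_div_neg_eq_neg_one_div,
    Odd.neg_pow (by decide)]
  set x := 1 / (z + L / 2)
  set y := 1 / (L / 2 - z)
  have hx : 0 < x := by positivity
  have hy : 0 < y := by positivity
  have aux : ∀ {x y : ℝ}, 0 < x → 0 < y → y ≤ x → (-12 * δ * (x ^ 13 + -y ^ 13)) ^ 2 *
      Real.exp (-β * (δ * (x ^ 12 + y ^ 12))) ≤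
      144 * δ ^ 2 * (x ^ 26 * Real.exp (-(β * δ) * x ^ 12)) := by
    intro x y hx hy hxy
    have h1 : y ^ 13 ≤ x ^ 13 := by gcongr
    have h2 : 0 < y ^ 13 := by positivity
    have h3 : (-12 * δ * (x ^ 13 + -y ^ 13)) ^ 2 ≤ 144 * δ ^ 2 * x ^ 26 := by
      have : (x ^ 13 - y ^ 13) ^ 2 ≤ (x ^ 13) ^ 2 := by nlinarith
      calc (-12 * δ * (x ^ 13 + -y ^ 13)) ^ 2 = 144 * δ ^ 2 * (x ^ 13 - y ^ 13) ^ 2 := by ring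
        _ ≤ 144 * δ ^ 2 * (x ^ 13) ^ 2 := by gcongr
        _ = _ := by ring
    have h4 : Real.exp (-β * (δ * (x ^ 12 + y ^ 12))) ≤ Real.exp (-(β * δ) * x ^ 12) := by
      refine Real.exp_le_exp.2 ?_
      have : 0 < β * δ * y ^ 12 := by positivity
      linarith
    calc _ ≤ 144 * δ ^ 2 * x ^ 26 * Real.exp (-(β * δ) * x ^ 12) := by gcongr
      _ = _ := by ring
  rw [mul_add (144 * δ ^ 2)]
  rcases le_total y x with h | h
  · exact (aux hx hy h).trans (le_add_of_nonneg_right (by positivity))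
  · have := aux hy hx h
    rw [add_comm (y ^ 12)] at this
    have h5 : 0 ≤ 144 * δ ^ 2 * (x ^ 26 * Real.exp (-(β * δ) * x ^ 12)) := by positivity
    have e : (-12 * δ * (y ^ 13 + -x ^ 13)) ^ 2 = (-12 * δ * (x ^ 13 + -y ^ 13)) ^ 2 := by ring
    rw [e] at this
    linarith

theorem integrableOn_force_sq (hβ : 0 < β) (hδ : 0 < δ) :
    IntegrableOn (fun z => deriv (wallPotential δ L) z ^ 2 * Real.exp (-β * wallPotential δ L z))
      (Ioo (-(L / 2)) (L / 2)) ∧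
    ∫ z in Ioo (-(L / 2)) (L / 2),
      deriv (wallPotential δ L) z ^ 2 * Real.exp (-β * wallPotential δ L z) ≤
      24 * δ ^ 2 * ((β * δ) ^ (-(25 / 12) : ℝ) * Real.Gamma (25 / 12)) := by
  have hb : 0 < β * δ := mul_pos hβ hδ
  have hk := integrable_wallKernel hb
  have i1 : Integrable fun z => wallKernel (β * δ) (z + L / 2) := hk.comp_add_right _
  have i2 : Integrable fun z => wallKernel (β * δ) (L / 2 - z) := hk.comp_sub_left _
  have i3 : Integrable fun z =>
      144 * δ ^ 2 * (wallKernel (β * δ) (z + L / 2) + wallKernel (β * δ) (L / 2 - z)) :=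
    (i1.add i2).const_mul _
  have i4 : IntegrableOn
      (fun z => deriv (wallPotential δ L) z ^ 2 * Real.exp (-β * wallPotential δ L z))
      (Ioo (-(L / 2)) (L / 2)) := by
    refine Integrable.mono' i3.integrableOn (((continuousOn_deriv_wallPotential.pow 2).mul
      (Real.continuous_exp.comp_continuousOn (continuousOn_const.mul
        continuousOn_wallPotential))).aestronglyMeasurable measurableSet_Ioo) ?_
    refine (ae_restrict_iff' measurableSet_Ioo).2 (Eventually.of_forall fun z hz => ?_)
    rw [Real.norm_of_nonneg (by positivity)]
    exact force_sq_mul_boltzmann_le hβ hδ hz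
  refine ⟨i4, (setIntegral_mono_on i4 i3.integrableOn measurableSet_Ioo fun z hz =>
    force_sq_mul_boltzmann_le hβ hδ hz).trans ?_⟩
  refine (setIntegral_le_integral i3 (Eventually.of_forall fun z => mul_nonneg (by positivity)
    (add_nonneg (wallKernel_nonneg _ _) (wallKernel_nonneg _ _)))).trans (le_of_eq ?_)
  rw [integral_const_mul, integral_add i1 i2, integral_add_right_eq_self (wallKernel (β * δ)),
    integral_sub_left_eq_self (wallKernel (β * δ)), integral_wallKernel hb]
  ring

/-- At distance at least `r = (βδ)^(1/12)` from both walls each wall contributes at most `1` to `β`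
times the potential. Such points form an interval of length `L - 2 * r`, which exceeds `L / 3` by
the assumption on `r`. -/
theorem le_integral_boltzmann (hβ : 0 < β) (hδ : 0 < δ)
    (hβδ : (β * δ) ^ (1 / 12 : ℝ) < L / 3) :
    L / 3 * Real.exp (-2) ≤ ∫ z in Ioo (-(L / 2)) (L / 2), Real.exp (-β * wallPotential δ L z) := by
  have hb : 0 < β * δ := mul_pos hβ hδ
  set r := (β * δ) ^ (1 / 12 : ℝ) with hr
  have hr0 : 0 < r := Real.rpow_pos_of_pos hb _
  have hr12 : r ^ 12 = β * δ := by
    rw [hr, ← Real.rpow_natCast, ← Real.rpow_mul hb.le]; norm_num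
  have hsub : Icc (-(L / 2) + r) (L / 2 - r) ⊆ Ioo (-(L / 2)) (L / 2) := fun z hz =>
    ⟨by linarith [hz.1], by linarith [hz.2]⟩
  have hint := integrableOn_boltzmann (L := L) hβ hδ
  have h1 : ∀ s, r ≤ s → β * δ * (1 / s) ^ 12 ≤ 1 := by
    intro s hs
    have hs0 : 0 < s := hr0.trans_le hs
    rw [one_div, inv_pow, ← div_eq_mul_inv, div_le_one (by positivity), ← hr12]
    gcongr
  have h2 := setIntegral_ge_of_const_le_real (μ := volume) (c := Real.exp (-2))
    (s := Icc (-(L / 2) + r) (L / 2 - r))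
    (f := fun z => Real.exp (-β * wallPotential δ L z)) measurableSet_Icc (by simp)
    (fun z hz => by
      refine Real.exp_le_exp.2 ?_
      rw [wallPotential_eq]
      have := h1 (z + L / 2) (by linarith [hz.1])
      have := h1 (L / 2 - z) (by linarith [hz.2])
      linarith) (hint.mono_set hsub)
  have h3 := setIntegral_mono_set hint (Eventually.of_forall fun z => Real.exp_nonneg _)
    (Eventually.of_forall hsub)
  refine le_trans ?_ (h2.trans h3)
  rw [Real.volume_real_Icc_of_le (by linarith), mul_comm]
  gcongr
  linarith

end WallPotential

/-! ### Numerical constants. -/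

section Constants

theorem integral_eq_Gamma :
    ∫ u in Ioi (0 : ℝ), u ^ (13 / 12 : ℝ) * Real.exp (-u) = Real.Gamma (25 / 12) := by
  rw [Real.Gamma_eq_integral (by norm_num)]
  refine setIntegral_congr_fun measurableSet_Ioi fun u _ => ?_
  norm_num [mul_comm]

theorem one_lt_Gamma : 1 < Real.Gamma (25 / 12) := by
  have := Real.Gamma_strictMonoOn_Ici (mem_Ici.2 le_rfl) (mem_Ici.2 (by norm_num))
    (by norm_num : (2 : ℝ) < 25 / 12)
  rwa [Real.Gamma_two] at this

/-- The chord of the convex function Γ between `2` and `3`, at `25 / 12 = 11 / 12 * 2 + 1 / 12 * 3`.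
-/
theorem Gamma_le : Real.Gamma (25 / 12) ≤ 13 / 12 := by
  have h3 : Real.Gamma 3 = 2 := by simp
  have := Real.convexOn_Gamma.2 (mem_Ioi.2 (by norm_num : (0 : ℝ) < 2))
    (mem_Ioi.2 (by norm_num : (0 : ℝ) < 3)) (by norm_num : (0 : ℝ) ≤ 11 / 12)
    (by norm_num : (0 : ℝ) ≤ 1 / 12) (by norm_num)
  rw [Real.Gamma_two, h3] at this
  norm_num at this
  exact this

theorem abs_c_sub_lt : |c - 25| < 1 := by
  rw [c, integral_eq_Gamma]
  have h1 : 1 < √(Real.Gamma (25 / 12)) := by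
    rw [Real.lt_sqrt zero_le_one]; simpa using one_lt_Gamma
  have h2 : √(Real.Gamma (25 / 12)) < 13 / 12 := by
    rw [Real.sqrt_lt' (by norm_num)]
    linarith [Gamma_le]
  rw [abs_lt]
  constructor <;> linarith

theorem sq_t₀ {β δ L : ℝ} (hβ : 0 < β) (hδ : 0 < δ) (hL : 0 < L) :
    t₀ β δ L ^ 2 = (β * δ) ^ (1 / 12 : ℝ) * (L * β) / (576 * Real.Gamma (25 / 12)) := by
  have hb : 0 < β * δ := mul_pos hβ hδ
  rw [t₀, mul_pow, mul_pow, Real.sq_sqrt (by positivity), ← Real.rpow_natCast, ← Real.rpow_natCast,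
    ← Real.rpow_mul hb.le, c, integral_eq_Gamma, Real.rpow_natCast, div_pow, mul_pow,
    Real.sq_sqrt (by linarith [one_lt_Gamma])]
  norm_num
  ring

end Constants

/-! ### The force estimate up to time `t₀`, with and without field. -/

section ShortTimes

variable {β δ L : ℝ}

/-- Explains the form of `t₀`: its square cancels both the Gamma factor and all powers of `β * δ` in
the force bound. What remains is `L / 24`, a multiple `exp 2 / 8` of the lower bound for the
normalisation. -/
theorem sq_t₀_mul_integral_force_sq_le (hβ : 0 < β) (hδ : 0 < δ) (hL : 0 < L)
    (hβδ : (β * δ) ^ (1 / 12 : ℝ) < L / 3) :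
    t₀ β δ L ^ 2 * β * (∫ z in Ioo (-(L / 2)) (L / 2),
      deriv (wallPotential δ L) z ^ 2 * Real.exp (-β * wallPotential δ L z)) ≤
    Real.exp 2 / 8 * ∫ z in Ioo (-(L / 2)) (L / 2), Real.exp (-β * wallPotential δ L z) := by
  have hb : 0 < β * δ := mul_pos hβ hδ
  have hG := one_lt_Gamma
  have h1 := (integrableOn_force_sq (L := L) hβ hδ).2
  have h2 := le_integral_boltzmann hβ hδ hβδ
  have hpow : (β * δ) ^ (1 / 12 : ℝ) * (β * δ) ^ (-(25 / 12) : ℝ) * (β * δ) ^ 2 = 1 := by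
    rw [← Real.rpow_natCast, ← Real.rpow_add hb, ← Real.rpow_add hb]
    norm_num
  calc _ ≤ t₀ β δ L ^ 2 * β * (24 * δ ^ 2 * ((β * δ) ^ (-(25 / 12) : ℝ) * Real.Gamma (25 / 12))) :=
        mul_le_mul_of_nonneg_left h1 (by positivity)
    _ = L / 24 * ((β * δ) ^ (1 / 12 : ℝ) * (β * δ) ^ (-(25 / 12) : ℝ) * (β * δ) ^ 2) := by
        rw [sq_t₀ hβ hδ hL]
        field_simp
        ring
    _ = Real.exp 2 / 8 * (L / 3 * Real.exp (-2)) := by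
        rw [hpow, Real.exp_neg]
        field_simp
        norm_num
    _ ≤ _ := mul_le_mul_of_nonneg_left h2 (by positivity)

theorem exp_two_lt : Real.exp 2 / 8 < 1 := by
  have : Real.exp 2 = Real.exp 1 * Real.exp 1 := by rw [← Real.exp_add]; norm_num
  have h1 := Real.exp_one_lt_d9
  have h2 := Real.exp_pos 1
  rw [this]
  nlinarith

theorem boltzmann_tilted (β h z : ℝ) : Real.exp (-β * tiltedPotential δ L h z) =
    Real.exp (-β * wallPotential δ L z) * Real.exp (β * h * z) := by
  rw [tiltedPotential, ← Real.exp_add]; ring_nf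

theorem exp_mul_mem {h z : ℝ} (hβ : 0 < β) (hh : 0 ≤ h) (hz : z ∈ Ioo (-(L / 2)) (L / 2)) :
    (Real.exp (β * h * (L / 2)))⁻¹ ≤ Real.exp (β * h * z) ∧
      Real.exp (β * h * z) ≤ Real.exp (β * h * (L / 2)) := by
  have := mul_nonneg hβ.le hh
  rw [← Real.exp_neg]
  exact ⟨Real.exp_le_exp.2 (by nlinarith [hz.1]), Real.exp_le_exp.2 (by nlinarith [hz.2])⟩

theorem deriv_tiltedPotential {z : ℝ} (h : ℝ) (hz : z ∈ Ioo (-(L / 2)) (L / 2)) :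
    deriv (tiltedPotential δ L h) z = deriv (wallPotential δ L) z - h := by
  rw [(hasDerivAt_tiltedPotential h hz).deriv, (hasDerivAt_wallPotential hz).deriv]

theorem tilted_force_sq_le {h z : ℝ} (hβ : 0 < β) (hh : 0 ≤ h)
    (hz : z ∈ Ioo (-(L / 2)) (L / 2)) :
    deriv (tiltedPotential δ L h) z ^ 2 * Real.exp (-β * tiltedPotential δ L h z) ≤
      Real.exp (β * h * (L / 2)) * (2 * (deriv (wallPotential δ L) z ^ 2 *
        Real.exp (-β * wallPotential δ L z)) +
        2 * h ^ 2 * Real.exp (-β * wallPotential δ L z)) := by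
  rw [deriv_tiltedPotential h hz, boltzmann_tilted]
  set f := deriv (wallPotential δ L) z
  -- The factor `2` lost here is later compensated by the `1 / 2` in front of `t₀ ^ 2`.
  have h1 : (f - h) ^ 2 ≤ 2 * f ^ 2 + 2 * h ^ 2 := by nlinarith [sq_nonneg (f + h)]
  calc _ ≤ (2 * f ^ 2 + 2 * h ^ 2) * (Real.exp (-β * wallPotential δ L z) *
        Real.exp (β * h * (L / 2))) := by
        refine mul_le_mul h1 (mul_le_mul_of_nonneg_left (exp_mul_mem hβ hh hz).2
          (Real.exp_nonneg _)) (by positivity) (by positivity)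
    _ = _ := by ring

theorem integrableOn_tilted_force_sq {h : ℝ} (hβ : 0 < β) (hδ : 0 < δ) (hL : 0 < L) (hh : 0 ≤ h) :
    IntegrableOn (fun z => deriv (tiltedPotential δ L h) z ^ 2 *
      Real.exp (-β * tiltedPotential δ L h z)) (Ioo (-(L / 2)) (L / 2)) := by
  have hU := confiningPotential_tilted hδ hL h
  have i1 := (integrableOn_force_sq (L := L) hβ hδ).1
  have i2 := integrableOn_boltzmann (L := L) hβ hδ
  refine Integrable.mono' (((i1.const_mul 2).add (i2.const_mul (2 * h ^ 2))).const_mul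
    (Real.exp (β * h * (L / 2)))) (ContinuousOn.aestronglyMeasurable (fun z hz => ?_)
      measurableSet_Ioo) ?_
  · exact (((hU.contDiffAt_deriv hz).continuousAt.pow 2).mul
      (continuousAt_const.mul (hU.contDiffAt hz).continuousAt).rexp).continuousWithinAt
  · refine (ae_restrict_iff' measurableSet_Ioo).2 (Eventually.of_forall fun z hz => ?_)
    rw [Real.norm_of_nonneg (by positivity)]
    exact tilted_force_sq_le hβ hh hz

theorem integrableOn_tilted_boltzmann {h : ℝ} (hβ : 0 < β) (hδ : 0 < δ) (hh : 0 ≤ h) :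
    IntegrableOn (fun z => Real.exp (-β * tiltedPotential δ L h z)) (Ioo (-(L / 2)) (L / 2)) := by
  refine Integrable.mono' ((integrableOn_boltzmann (L := L) hβ hδ).mul_const
    (Real.exp (β * h * (L / 2)))) (ContinuousOn.aestronglyMeasurable (fun z hz => ?_)
      measurableSet_Ioo) ?_
  · exact (continuousAt_const.mul ((contDiffAt_wallPotential (n := 0) hz).continuousAt.sub
      (continuousAt_const.mul continuousAt_id))).rexp.continuousWithinAt
  · refine (ae_restrict_iff' measurableSet_Ioo).2 (Eventually.of_forall fun z hz => ?_)
    rw [Real.norm_of_nonneg (by positivity), boltzmann_tilted]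
    exact mul_le_mul_of_nonneg_left (exp_mul_mem hβ hh hz).2 (Real.exp_nonneg _)

/-- For weak fields the mean square force controls the autocorrelation of the momentum up to the
time `t₀`. -/
theorem eventually_force_le (hβ : 0 < β) (hδ : 0 < δ) (hL : 0 < L)
    (hβδ : (β * δ) ^ (1 / 12 : ℝ) < L / 3) :
    ∀ᶠ h : ℝ in 𝓝[>] 0, t₀ β δ L ^ 2 / 2 * β * (∫ z in Ioo (-(L / 2)) (L / 2),
        deriv (tiltedPotential δ L h) z ^ 2 * Real.exp (-β * tiltedPotential δ L h z)) ≤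
      (2 - Real.exp (β * h * (L / 2))) *
        ∫ z in Ioo (-(L / 2)) (L / 2), Real.exp (-β * tiltedPotential δ L h z) := by
  have i1 := (integrableOn_force_sq (L := L) hβ hδ).1
  have i2 := integrableOn_boltzmann (L := L) hβ hδ
  set I₀ := ∫ z in Ioo (-(L / 2)) (L / 2), Real.exp (-β * wallPotential δ L z) with hI₀
  have hI₀p : 0 < I₀ := lt_of_lt_of_le (by positivity) (le_integral_boltzmann hβ hδ hβδ)
  set κ : ℝ → ℝ := fun h => Real.exp (β * h * (L / 2)) with hκ
  have hκc : Continuous κ := by fun_prop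
  -- At `h = 0` this reads `exp 2 / 8 < 1`; continuity in `h` does the rest.
  have hsmall : ∀ᶠ h : ℝ in 𝓝 0,
      κ h * (Real.exp 2 / 8 + t₀ β δ L ^ 2 * β * h ^ 2) < (2 - κ h) * (κ h)⁻¹ := by
    have hcl : Continuous fun h => κ h * (Real.exp 2 / 8 + t₀ β δ L ^ 2 * β * h ^ 2) := by
      fun_prop
    have hcr : Continuous fun h => (2 - κ h) * (κ h)⁻¹ :=
      (continuous_const.sub hκc).mul (hκc.inv₀ fun h => (Real.exp_pos _).ne')
    refine hcl.continuousAt.eventually_lt hcr.continuousAt ?_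
    simp only [hκ]
    norm_num
    linarith [exp_two_lt]
  filter_upwards [hsmall.filter_mono nhdsWithin_le_nhds, self_mem_nhdsWithin] with h hlt hh
  have hh0 : 0 ≤ h := le_of_lt hh
  have hκ0 : 0 < κ h := Real.exp_pos _
  have hup : ∫ z in Ioo (-(L / 2)) (L / 2),
      deriv (tiltedPotential δ L h) z ^ 2 * Real.exp (-β * tiltedPotential δ L h z) ≤
      κ h * (2 * (∫ z in Ioo (-(L / 2)) (L / 2),
        deriv (wallPotential δ L) z ^ 2 * Real.exp (-β * wallPotential δ L z)) +
        2 * h ^ 2 * I₀) := by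
    refine (setIntegral_mono_on (integrableOn_tilted_force_sq hβ hδ hL hh0)
      (((i1.const_mul 2).add (i2.const_mul (2 * h ^ 2))).const_mul (κ h)) measurableSet_Ioo
      fun z hz => tilted_force_sq_le hβ hh0 hz).trans (le_of_eq ?_)
    simp only [Pi.add_apply]
    rw [integral_const_mul, integral_add (i1.const_mul 2) (i2.const_mul _), integral_const_mul,
      integral_const_mul]
  have hlow : (κ h)⁻¹ * I₀ ≤
      ∫ z in Ioo (-(L / 2)) (L / 2), Real.exp (-β * tiltedPotential δ L h z) := by
    rw [hI₀, ← integral_const_mul]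
    refine setIntegral_mono_on (i2.const_mul _) (integrableOn_tilted_boltzmann hβ hδ hh0)
      measurableSet_Ioo fun z hz => ?_
    rw [boltzmann_tilted, mul_comm]
    gcongr
    exact (exp_mul_mem hβ hh0 hz).1
  have hmain := sq_t₀_mul_integral_force_sq_le hβ hδ hL hβδ
  rw [← hI₀] at hmain
  -- The positive left side of `hlt` forces this sign, which the last step needs to insert the lower
  -- bound `hlow`.
  have h2κ : 0 ≤ 2 - κ h := by
    have h1 : 0 ≤ κ h * (Real.exp 2 / 8 + t₀ β δ L ^ 2 * β * h ^ 2) := by positivity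
    have h2 := h1.trans hlt.le
    exact (mul_nonneg_iff_of_pos_right (inv_pos.2 hκ0)).1 h2
  calc _ ≤ t₀ β δ L ^ 2 / 2 * β * (κ h * (2 * (∫ z in Ioo (-(L / 2)) (L / 2),
        deriv (wallPotential δ L) z ^ 2 * Real.exp (-β * wallPotential δ L z)) +
        2 * h ^ 2 * I₀)) := mul_le_mul_of_nonneg_left hup (by positivity)
    _ = κ h * (t₀ β δ L ^ 2 * β * (∫ z in Ioo (-(L / 2)) (L / 2),
        deriv (wallPotential δ L) z ^ 2 * Real.exp (-β * wallPotential δ L z)) +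
        t₀ β δ L ^ 2 * β * h ^ 2 * I₀) := by ring
    _ ≤ κ h * (Real.exp 2 / 8 * I₀ + t₀ β δ L ^ 2 * β * h ^ 2 * I₀) := by gcongr
    _ = κ h * (Real.exp 2 / 8 + t₀ β δ L ^ 2 * β * h ^ 2) * I₀ := by ring
    _ ≤ (2 - κ h) * (κ h)⁻¹ * I₀ := by gcongr
    _ = (2 - κ h) * ((κ h)⁻¹ * I₀) := by ring
    _ ≤ _ := mul_le_mul_of_nonneg_left hlow h2κ

end ShortTimes

end GasInBox

namespace GasInBox

/-! ### Positivity of the momentum autocorrelation up to `t₀`. -/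

section OneParticleResponse

variable {β δ L h : ℝ}

/-- The mean momentum of one particle does not decrease up to the time `t₀` if the field is weak. -/
theorem integral_momentum_mul_nonneg_of_le (hβ : 0 < β) (hδ : 0 < δ) (hL : 0 < L) (hh : 0 ≤ h)
    (hle : t₀ β δ L ^ 2 / 2 * β * (∫ z in Ioo (-(L / 2)) (L / 2),
        deriv (tiltedPotential δ L h) z ^ 2 * Real.exp (-β * tiltedPotential δ L h z)) ≤
      (2 - Real.exp (β * h * (L / 2))) *
        ∫ z in Ioo (-(L / 2)) (L / 2), Real.exp (-β * tiltedPotential δ L h z))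
    {φ : ℝ → ℝ × ℝ → ℝ × ℝ} (hφ : IsConfinedFlow (L / 2) (tiltedPotential δ L h) φ) {t : ℝ}
    (ht : 0 ≤ t) (htt : t ≤ t₀ β δ L) :
    0 ≤ ∫ x in strip (L / 2), x.2 * (φ (-t) x).2 *
      Real.exp (-β * (energy (tiltedPotential δ L h) x + h * (φ (-t) x).1)) := by
  have hb : 0 < β / 2 := by positivity
  have hexp : ∀ x : ℝ × ℝ, Real.exp (-β * energy (tiltedPotential δ L h) x) =
      Real.exp (-β * tiltedPotential δ L h x.1) * Real.exp (-(β / 2) * x.2 ^ 2) := by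
    intro x
    rw [energy, ← Real.exp_add]; ring_nf
  have e1 : ∀ x : ℝ × ℝ, deriv (tiltedPotential δ L h) x.1 ^ 2 *
      Real.exp (-β * energy (tiltedPotential δ L h) x) =
      (deriv (tiltedPotential δ L h) x.1 ^ 2 * Real.exp (-β * tiltedPotential δ L h x.1)) *
        Real.exp (-(β / 2) * x.2 ^ 2) := fun x => by rw [hexp]; ring
  have e2 : ∀ x : ℝ × ℝ, x.2 ^ 2 * Real.exp (-β * energy (tiltedPotential δ L h) x) =
      Real.exp (-β * tiltedPotential δ L h x.1) * (x.2 ^ 2 * Real.exp (-(β / 2) * x.2 ^ 2)) :=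
    fun x => by rw [hexp]; ring
  refine hφ.integral_momentum_mul_nonneg (confiningPotential_tilted hδ hL h) hβ hh ?_ ht ?_
  · simp only [e1]
    exact integrableOn_strip_mul (f := fun z => deriv (tiltedPotential δ L h) z ^ 2 *
      Real.exp (-β * tiltedPotential δ L h z)) (integrableOn_tilted_force_sq hβ hδ hL hh)
      (integrable_exp_neg_mul_sq hb)
  · simp only [e1, e2]
    rw [integral_strip_mul (L / 2) (fun z => deriv (tiltedPotential δ L h) z ^ 2 *
        Real.exp (-β * tiltedPotential δ L h z)) (fun p => Real.exp (-(β / 2) * p ^ 2)),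
      integral_strip_mul (L / 2) (fun z => Real.exp (-β * tiltedPotential δ L h z))
        (fun p => p ^ 2 * Real.exp (-(β / 2) * p ^ 2)), integral_sq_mul_gaussian hb]
    set G := ∫ p : ℝ, Real.exp (-(β / 2) * p ^ 2)
    have hG : 0 ≤ G := integral_nonneg fun p => Real.exp_nonneg _
    set F := ∫ z in Ioo (-(L / 2)) (L / 2),
        deriv (tiltedPotential δ L h) z ^ 2 * Real.exp (-β * tiltedPotential δ L h z)
    have hF : 0 ≤ F := integral_nonneg fun z => by positivity
    set I := ∫ z in Ioo (-(L / 2)) (L / 2), Real.exp (-β * tiltedPotential δ L h z)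
    have h1 : t ^ 2 ≤ t₀ β δ L ^ 2 := by gcongr
    have h2 : t ^ 2 / 2 * β * F ≤ (2 - Real.exp (β * h * (L / 2))) * I :=
      le_trans (by gcongr) hle
    calc t ^ 2 / 2 * (F * G) = t ^ 2 / 2 * β * F * (G / β) := by field_simp
      _ ≤ (2 - Real.exp (β * h * (L / 2))) * I * (G / β) := by gcongr
      _ = _ := by field_simp

end OneParticleResponse

/-! ### Poisson brackets with the Hamiltonian. -/

section Mechanics

variable {N : ℕ} {β δ L h : ℝ}

/-- The Hamiltonian vector field of `H₁`. -/
noncomputable def phaseField (N : ℕ) (δ L h : ℝ) (x : Phase N) : Phase N :=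
  (x.2, fun j α => if α = 2 then -deriv (tiltedPotential δ L h) (x.1 j 2) else 0)

theorem differentiableAt_H₁ {x : Phase N} (hx : ∀ j, x.1 j 2 ∈ Ioo (-(L / 2)) (L / 2)) :
    DifferentiableAt ℝ (H₁ N δ L h) x := by
  have hV : ∀ j, DifferentiableAt ℝ (fun x : Phase N => wallPotential δ L (x.1 j 2)) x := by
    intro j
    have h1 : DifferentiableAt ℝ (wallPotential δ L) (x.1 j 2) :=
      (hasDerivAt_wallPotential (hx j)).differentiableAt
    have h2 : DifferentiableAt ℝ (fun x : Phase N => x.1 j 2) x := by fun_prop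
    exact DifferentiableAt.comp (g := wallPotential δ L) x h1 h2
  unfold H₁ H₀ A
  fun_prop (disch := assumption)

theorem fderiv_H₁ {x : Phase N} (hx : ∀ j, x.1 j 2 ∈ Ioo (-(L / 2)) (L / 2)) (v : Phase N) :
    fderiv ℝ (H₁ N δ L h) x v = ∑ j, ∑ α, x.2 j α * v.2 j α +
      ∑ j, deriv (tiltedPotential δ L h) (x.1 j 2) * v.1 j 2 := by
  have hline : HasDerivAt (fun s : ℝ => x + s • v) v 0 := by
    simpa using! ((hasDerivAt_id (0 : ℝ)).smul_const v).const_add x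
  have hd : HasFDerivAt (H₁ N δ L h) (fderiv ℝ (H₁ N δ L h) x) (x + (0 : ℝ) • v) := by
    simpa using (differentiableAt_H₁ (δ := δ) (h := h) hx).hasFDerivAt
  have h1 := hd.comp_hasDerivAt (0 : ℝ) hline
  have hp : ∀ j α, HasDerivAt (fun s : ℝ => x.2 j α + s * v.2 j α) (v.2 j α) 0 := fun j α => by
    simpa using ((hasDerivAt_id (0 : ℝ)).mul_const (v.2 j α)).const_add (x.2 j α)
  have hq : ∀ j α, HasDerivAt (fun s : ℝ => x.1 j α + s * v.1 j α) (v.1 j α) 0 := fun j α => by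
    simpa using ((hasDerivAt_id (0 : ℝ)).mul_const (v.1 j α)).const_add (x.1 j α)
  have hT : HasDerivAt (fun s : ℝ => ∑ j, (∑ α, (x.2 j α + s * v.2 j α) ^ 2) / 2)
      (∑ j, ∑ α, x.2 j α * v.2 j α) 0 := by
    refine HasDerivAt.fun_sum fun j _ => ?_
    have := (HasDerivAt.fun_sum fun α (_ : α ∈ Finset.univ) => (hp j α).pow 2).div_const 2
    refine this.congr_deriv ?_
    rw [Finset.sum_div]
    refine Finset.sum_congr rfl fun α _ => ?_
    simp
    ring
  have hU : HasDerivAt (fun s : ℝ => ∑ j, tiltedPotential δ L h (x.1 j 2 + s * v.1 j 2))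
      (∑ j, deriv (tiltedPotential δ L h) (x.1 j 2) * v.1 j 2) 0 := by
    refine HasDerivAt.fun_sum fun j _ => ?_
    have h2 : HasDerivAt (tiltedPotential δ L h) (deriv (tiltedPotential δ L h) (x.1 j 2))
        (x.1 j 2 + 0 * v.1 j 2) := by
      simpa using (hasDerivAt_tiltedPotential h (hx j)).differentiableAt.hasDerivAt
    exact h2.comp (0 : ℝ) (hq j 2)
  have h2 := hT.add hU
  refine h1.unique (h2.congr_of_eventuallyEq (Eventually.of_forall fun s => ?_))
  simp only [Function.comp_apply, H₁, H₀, A, tiltedPotential, Pi.add_apply]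
  simp only [Prod.fst_add, Prod.snd_add, Prod.smul_fst, Prod.smul_snd, Pi.add_apply, Pi.smul_apply,
    smul_eq_mul, Finset.sum_sub_distrib, Finset.mul_sum]
  ring

theorem partialP_H₁ {x : Phase N} (hx : ∀ j, x.1 j 2 ∈ Ioo (-(L / 2)) (L / 2)) (j : Fin N)
    (α : Fin 3) : partialP (H₁ N δ L h) j α x = x.2 j α := by
  simp only [partialP, fderiv_H₁ hx, Pi.zero_apply, mul_zero, Finset.sum_const_zero, add_zero]
  rw [Finset.sum_eq_single j, Finset.sum_eq_single α]
  · simp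
  · intro γ _ hγ
    simp [hγ]
  · simp
  · intro i _ hi
    simp [hi]
  · simp

theorem partialQ_H₁ {x : Phase N} (hx : ∀ j, x.1 j 2 ∈ Ioo (-(L / 2)) (L / 2)) (j : Fin N)
    (α : Fin 3) : partialQ (H₁ N δ L h) j α x =
      if α = 2 then deriv (tiltedPotential δ L h) (x.1 j 2) else 0 := by
  simp only [partialQ, fderiv_H₁ hx, Pi.zero_apply, mul_zero, Finset.sum_const_zero, zero_add]
  rw [Finset.sum_eq_single j]
  · by_cases hα : α = 2
    · subst hα; simp
    · simp [hα, Ne.symm hα]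
  · intro i _ hi
    simp [hi]
  · simp

theorem phase_eq_sum (v : Phase N) : v =
    ∑ j, ∑ α, (v.1 j α • ((Pi.single j (Pi.single α 1), 0) : Phase N) +
      v.2 j α • ((0, Pi.single j (Pi.single α 1)) : Phase N)) := by
  refine Prod.ext ?_ ?_ <;> ext i γ <;>
  · simp only [Prod.fst_sum, Prod.snd_sum, Prod.fst_add, Prod.snd_add, Prod.smul_fst,
      Prod.smul_snd, Finset.sum_apply, Pi.add_apply, Pi.smul_apply, smul_eq_mul, Pi.zero_apply,
      mul_zero, add_zero, zero_add]
    rw [Finset.sum_eq_single i, Finset.sum_eq_single γ]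
    · simp
    · intro α _ hα
      simp [Ne.symm hα]
    · simp
    · intro j _ hj
      simp [Ne.symm hj]
    · simp

theorem fderiv_eq_sum_partial (f : Phase N → ℝ) (x v : Phase N) :
    fderiv ℝ f x v = ∑ j, ∑ α, (v.1 j α * partialQ f j α x + v.2 j α * partialP f j α x) := by
  conv_lhs => rw [phase_eq_sum v]
  simp only [map_sum, map_add, map_smul, smul_eq_mul, partialQ, partialP]

/-- Makes Liouville's equation a transport equation: the total derivative of a solution along
`phaseField` vanishes. -/
theorem poissonBracket_H₁ {x : Phase N} (hx : ∀ j, x.1 j 2 ∈ Ioo (-(L / 2)) (L / 2))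
    (f : Phase N → ℝ) :
    poissonBracket (H₁ N δ L h) f x = -fderiv ℝ f x (phaseField N δ L h x) := by
  rw [fderiv_eq_sum_partial, poissonBracket, ← Finset.sum_neg_distrib]
  refine Finset.sum_congr rfl fun j _ => ?_
  rw [← Finset.sum_neg_distrib]
  refine Finset.sum_congr rfl fun α _ => ?_
  rw [partialP_H₁ hx, partialQ_H₁ hx, phaseField]
  by_cases hα : α = 2
  · simp only [hα, if_true]; ring
  · simp only [hα, if_false]; ring

theorem H₁_zero : H₁ N δ L 0 = H₀ N δ L := by
  ext x
  simp [H₁]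

theorem B_eq {x : Phase N} (hx : x ∈ phaseSpace N L) : B N δ L x = ∑ j, x.2 j 2 := by
  have hA : ∀ v : Phase N, fderiv ℝ (A N) x v = ∑ j, v.1 j 2 := by
    intro v
    have : HasFDerivAt (A N) (∑ j : Fin N, (ContinuousLinearMap.proj (R := ℝ) (2 : Fin 3)) ∘L
        (ContinuousLinearMap.proj (R := ℝ) (φ := fun _ : Fin N => Fin 3 → ℝ) j) ∘L
        (ContinuousLinearMap.fst ℝ (Fin N → Fin 3 → ℝ) (Fin N → Fin 3 → ℝ))) x := by
      refine HasFDerivAt.congr_of_eventuallyEq (ContinuousLinearMap.hasFDerivAt _)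
        (Eventually.of_forall fun y => ?_)
      simp [A]
    rw [this.fderiv]
    simp
  have hP : ∀ j α, partialP (A N) j α x = 0 := fun j α => by simp [partialP, hA]
  have hQ : ∀ j α, partialQ (A N) j α x = if α = 2 then 1 else 0 := by
    intro j α
    simp only [partialQ, hA]
    rw [Finset.sum_eq_single j]
    · by_cases hα : α = 2
      · subst hα; simp
      · simp [hα, Ne.symm hα]
    · intro i _ hi
      simp [hi]
    · simp
  rw [B, poissonBracket, ← H₁_zero]
  refine Finset.sum_congr rfl fun j _ => ?_
  simp [hP, hQ, partialP_H₁ fun j => hx j 2]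

end Mechanics

/-! ### Existence of a solution. -/

section ExplicitSolution

variable {N : ℕ} {β δ L h : ℝ} {φ : ℝ → ℝ × ℝ → ℝ × ℝ}

/-- The initial energy of the phase point which the vertical flow `φ` carries to `x` in time `t`. -/
noncomputable def pulledBackEnergy (δ L : ℝ) (φ : ℝ → ℝ × ℝ → ℝ × ℝ) (t : ℝ) (x : Phase N) : ℝ :=
  ∑ j, ((x.2 j 0 ^ 2 + x.2 j 1 ^ 2) / 2 +
    energy (wallPotential δ L) (φ (-t) (x.1 j 2, x.2 j 2)))

/-- The solution of Liouville's equation with the Gibbs density as initial datum. -/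
noncomputable def evolvedDensity (N : ℕ) (β δ L : ℝ) (φ : ℝ → ℝ × ℝ → ℝ × ℝ) (t : ℝ)
    (x : Phase N) : ℝ :=
  Real.exp (-β * pulledBackEnergy δ L φ t x) /
    ∫ y in phaseSpace N L, Real.exp (-β * H₀ N δ L y)

theorem H₀_eq (x : Phase N) : H₀ N δ L x =
    ∑ j, ((x.2 j 0 ^ 2 + x.2 j 1 ^ 2) / 2 + energy (wallPotential δ L) (x.1 j 2, x.2 j 2)) := by
  rw [H₀, ← Finset.sum_add_distrib]
  refine Finset.sum_congr rfl fun j _ => ?_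
  rw [Fin.sum_univ_three, energy]
  ring

theorem differentiableAt_evolvedDensity
    (hφ : IsConfinedFlow (L / 2) (tiltedPotential δ L h) φ) (t : ℝ) {x : Phase N}
    (hx : ∀ j, x.1 j 2 ∈ Ioo (-(L / 2)) (L / 2)) :
    DifferentiableAt ℝ (fun y : ℝ × Phase N => evolvedDensity N β δ L φ y.1 y.2) (t, x) := by
  have hflow : ∀ j, DifferentiableAt ℝ
      (fun y : ℝ × Phase N => φ (-y.1) (y.2.1 j 2, y.2.2 j 2)) (t, x) := by
    intro j
    have h1 : DifferentiableAt ℝ (fun y : ℝ × (ℝ × ℝ) => φ y.1 y.2) (-t, (x.1 j 2, x.2 j 2)) :=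
      hφ.differentiableAt _ _ (mem_strip.2 (hx j))
    have h2 : DifferentiableAt ℝ
        (fun y : ℝ × Phase N => ((-y.1, (y.2.1 j 2, y.2.2 j 2)) : ℝ × (ℝ × ℝ))) (t, x) := by
      fun_prop
    exact DifferentiableAt.comp (g := fun y : ℝ × (ℝ × ℝ) => φ y.1 y.2) (t, x) h1 h2
  have hen : ∀ j, DifferentiableAt ℝ (fun y : ℝ × Phase N =>
      energy (wallPotential δ L) (φ (-y.1) (y.2.1 j 2, y.2.2 j 2))) (t, x) := by
    intro j
    have hV : DifferentiableAt ℝ (wallPotential δ L) (φ (-t) (x.1 j 2, x.2 j 2)).1 :=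
      (hasDerivAt_wallPotential
        (mem_strip.1 (hφ.mem (-t) _ (mem_strip.2 (hx j))))).differentiableAt
    have h3 := DifferentiableAt.comp (g := wallPotential δ L) (t, x) hV (hflow j).fst
    have h4 := (hflow j).snd
    unfold energy
    exact DifferentiableAt.add (by fun_prop) h3
  unfold evolvedDensity pulledBackEnergy
  fun_prop (disch := assumption)

/-- The phase flow without the horizontal walls. -/
noncomputable def freeFlow (φ : ℝ → ℝ × ℝ → ℝ × ℝ) (s : ℝ) (x : Phase N) : Phase N :=
  (fun j α => if α = 2 then (φ s (x.1 j 2, x.2 j 2)).1 else x.1 j α + s * x.2 j α,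
    fun j α => if α = 2 then (φ s (x.1 j 2, x.2 j 2)).2 else x.2 j α)

theorem hasDerivAt_freeFlow (hφ : IsConfinedFlow (L / 2) (tiltedPotential δ L h) φ)
    {x : Phase N} (hx : ∀ j, x.1 j 2 ∈ Ioo (-(L / 2)) (L / 2)) (s : ℝ) :
    HasDerivAt (fun s => freeFlow φ s x) (phaseField N δ L h (freeFlow φ s x)) s := by
  have hd := fun j => hφ.hasDerivAt s (x.1 j 2, x.2 j 2) (mem_strip.2 (hx j))
  refine HasDerivAt.prodMk ?_ ?_
  · refine hasDerivAt_pi.2 fun j => hasDerivAt_pi.2 fun α => ?_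
    by_cases hα : α = 2
    · simpa [phaseField, freeFlow, hα, hamiltonianField] using (hd j).prod_fst
    · simpa [phaseField, freeFlow, hα] using
        ((hasDerivAt_id s).mul_const (x.2 j α)).const_add (x.1 j α)
  · refine hasDerivAt_pi.2 fun j => hasDerivAt_pi.2 fun α => ?_
    by_cases hα : α = 2
    · simpa [phaseField, freeFlow, hα, hamiltonianField] using (hd j).prod_snd
    · simpa [phaseField, freeFlow, hα] using hasDerivAt_const s (x.2 j α)

/-- Free horizontal motion keeps the horizontal momenta, and the vertical part is the group law of
`φ`. -/
theorem pulledBackEnergy_freeFlow (hφ : IsConfinedFlow (L / 2) (tiltedPotential δ L h) φ)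
    {x : Phase N} (hx : ∀ j, x.1 j 2 ∈ Ioo (-(L / 2)) (L / 2)) (t s : ℝ) :
    pulledBackEnergy δ L φ (t + s) (freeFlow φ s x) = pulledBackEnergy δ L φ t x := by
  refine Finset.sum_congr rfl fun j _ => ?_
  have := hφ.add (-(t + s)) s (x.1 j 2, x.2 j 2) (mem_strip.2 (hx j))
  rw [neg_add_rev, neg_add_cancel_comm] at this
  simp [freeFlow, this]

theorem fderiv_uncurry_apply {ρ : ℝ → Phase N → ℝ} {t : ℝ} {x : Phase N}
    (hρ : DifferentiableAt ℝ (fun y : ℝ × Phase N => ρ y.1 y.2) (t, x)) (v : Phase N) :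
    fderiv ℝ (fun y : ℝ × Phase N => ρ y.1 y.2) (t, x) (1, v) =
      deriv (fun s => ρ s x) t + fderiv ℝ (ρ t) x v := by
  have h1 : HasDerivAt (fun s => ρ s x)
      (fderiv ℝ (fun y : ℝ × Phase N => ρ y.1 y.2) (t, x) (1, 0)) t :=
    hρ.hasFDerivAt.comp_hasDerivAt (f := fun s : ℝ => (s, x)) t
      ((hasDerivAt_id t).prodMk (hasDerivAt_const t x))
  have h2 : HasFDerivAt (ρ t) ((fderiv ℝ (fun y : ℝ × Phase N => ρ y.1 y.2) (t, x)) ∘L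
      ((0 : Phase N →L[ℝ] ℝ).prod (ContinuousLinearMap.id ℝ (Phase N)))) x :=
    hρ.hasFDerivAt.comp (f := fun y : Phase N => (t, y)) x
      ((hasFDerivAt_const t x).prodMk (hasFDerivAt_id x))
  rw [h1.deriv, h2.fderiv]
  simp only [ContinuousLinearMap.comp_apply, ContinuousLinearMap.prod_apply,
    ContinuousLinearMap.id_apply, ← map_add]
  simp

theorem reflect_snd_apply (j i : Fin N) (α γ : Fin 3) (x : Phase N) :
    (reflect j α x).2 i γ = if i = j ∧ γ = α then -x.2 i γ else x.2 i γ := by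
  by_cases hi : i = j
  · subst hi
    by_cases hγ : γ = α
    · subst hγ; simp [reflect]
    · simp [reflect, hγ]
  · simp [reflect, hi]

/-- The density sees the horizontal coordinates only through squares of momenta. Hence reflections
do not change it, and the transport equation can be checked along `freeFlow`, which ignores the
vertical walls. -/
theorem isLiouvilleSolution_evolvedDensity
    (hφ : IsConfinedFlow (L / 2) (tiltedPotential δ L h) φ) :
    IsLiouvilleSolution L (H₁ N δ L h) (gibbsDensity β L (H₀ N δ L))
      (evolvedDensity N β δ L φ) where
  continuousOn y hy :=
    (differentiableAt_evolvedDensity hφ y.1 fun j => (hy.2 j).2.2).continuousAt.continuousWithinAt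
  differentiableAt t _ x hx := differentiableAt_evolvedDensity hφ t fun j => hx j 2
  liouville t ht x hx := by
    have hx2 := fun j => hx j 2
    have hd := differentiableAt_evolvedDensity (β := β) hφ t hx2
    rw [poissonBracket_H₁ hx2, eq_neg_iff_add_eq_zero, ← fderiv_uncurry_apply hd]
    have h0 : freeFlow φ 0 x = x := by
      refine Prod.ext ?_ ?_ <;> ext j α <;> by_cases hα : α = 2 <;> simp [freeFlow, hφ.zero, hα]
    have h1 : HasDerivAt (fun s => ((t + s, freeFlow φ s x) : ℝ × Phase N))
        (1, phaseField N δ L h x) 0 := by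
      have := hasDerivAt_freeFlow hφ hx2 0
      rw [h0] at this
      exact ((hasDerivAt_id (0 : ℝ)).const_add t).prodMk this
    have h2 : HasFDerivAt (fun y : ℝ × Phase N => evolvedDensity N β δ L φ y.1 y.2)
        (fderiv ℝ (fun y : ℝ × Phase N => evolvedDensity N β δ L φ y.1 y.2) (t, x))
        (t + 0, freeFlow φ 0 x) := by
      rw [h0, add_zero]; exact hd.hasFDerivAt
    refine (h2.comp_hasDerivAt 0 h1).unique ?_
    refine (hasDerivAt_const (0 : ℝ) (evolvedDensity N β δ L φ t x)).congr_of_eventuallyEq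
      (Eventually.of_forall fun s => ?_)
    simp [evolvedDensity, pulledBackEnergy_freeFlow hφ hx2]
  reflection t _ x _ j α hα _ := by
    have h2 : ∀ i, (reflect j α x).2 i 2 = x.2 i 2 := fun i => by
      rw [reflect_snd_apply, if_neg fun h => hα h.2.symm]
    have hsq : ∀ i γ, (reflect j α x).2 i γ ^ 2 = x.2 i γ ^ 2 := fun i γ => by
      rw [reflect_snd_apply]; split_ifs <;> ring
    have : pulledBackEnergy δ L φ t (reflect j α x) = pulledBackEnergy δ L φ t x :=
      Finset.sum_congr rfl fun i _ => by rw [hsq, hsq, h2]; rfl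
    rw [evolvedDensity, evolvedDensity, this]
  initial x _ := by
    simp [evolvedDensity, gibbsDensity, pulledBackEnergy, hφ.zero, H₀_eq]

end ExplicitSolution

end GasInBox

namespace GasInBox

/-! ### Uniqueness, by following reflected trajectories. -/

section Uniqueness

variable {N : ℕ} {β δ L h : ℝ} {φ : ℝ → ℝ × ℝ → ℝ × ℝ}

open Classical in
/-- Reversal of the momentum coordinates in `S`. -/
noncomputable def flipMomenta (S : Finset (Fin N × Fin 3)) (x : Phase N) : Phase N :=
  (x.1, fun j α => if (j, α) ∈ S then -x.2 j α else x.2 j α)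

/-- Several coordinates may hit walls at the same instant, so the single reflections are composed.
-/
theorem IsLiouvilleSolution.flipMomenta_eq {H init : Phase N → ℝ} {ρ : ℝ → Phase N → ℝ}
    (hρ : IsLiouvilleSolution L H init ρ) {t : ℝ} (ht : 0 ≤ t) {x : Phase N}
    (hx : x ∈ phaseSpaceWithWalls N L) (S : Finset (Fin N × Fin 3))
    (hS : ∀ i ∈ S, i.2 ≠ 2 ∧ |x.1 i.1 i.2| = L / 2) : ρ t (flipMomenta S x) = ρ t x := by
  classical
  induction S using Finset.induction_on with
  | empty => congr 1
  | insert a S ha ih =>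
    have e : flipMomenta (insert a S) x = reflect a.1 a.2 (flipMomenta S x) := by
      refine Prod.ext rfl ?_
      ext i γ
      rw [reflect_snd_apply]
      by_cases h : i = a.1 ∧ γ = a.2
      · have h' : (i, γ) = a := Prod.ext h.1 h.2
        have hn : (i, γ) ∉ S := h' ▸ ha
        simp only [flipMomenta, Finset.mem_insert, h', true_or, if_true, if_pos h]
        rw [if_neg (h' ▸ ha)]
      · have h' : (i, γ) ≠ a := fun h' => h ⟨congrArg Prod.fst h', congrArg Prod.snd h'⟩
        simp only [flipMomenta, Finset.mem_insert, h', false_or, if_neg h]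
    have hw := hS a (Finset.mem_insert_self a S)
    rw [e, hρ.reflection t ht (flipMomenta S x) hx a.1 a.2 hw.1 hw.2]
    exact ih fun i hi => hS i (Finset.mem_insert_of_mem hi)

/-- The position coordinate at time `s` of free motion through `x` at time `T`. -/
def unfolded (T : ℝ) (x : Phase N) (j : Fin N) (α : Fin 3) (s : ℝ) : ℝ :=
  x.1 j α + x.2 j α * (s - T)

theorem continuous_unfolded (T : ℝ) (x : Phase N) (j : Fin N) (α : Fin 3) :
    Continuous (unfolded T x j α) := by unfold unfolded; fun_prop

/-- The trajectory through `x` at time `T`, reflected into the box from the cell `k` of the unfolded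
configuration space. -/
noncomputable def foldedPoint (φ : ℝ → ℝ × ℝ → ℝ × ℝ) (L T : ℝ) (x : Phase N)
    (k : Fin N → Fin 3 → ℤ) (s : ℝ) : Phase N :=
  (fun j α => if α = 2 then (φ (s - T) (x.1 j 2, x.2 j 2)).1
      else (-1) ^ k j α * (unfolded T x j α s - k j α * L),
    fun j α => if α = 2 then (φ (s - T) (x.1 j 2, x.2 j 2)).2 else (-1) ^ k j α * x.2 j α)

/-- The unfolded trajectory is in the cell `k`. -/
def InCell (L T : ℝ) (x : Phase N) (k : Fin N → Fin 3 → ℤ) (s : ℝ) : Prop :=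
  ∀ j α, |unfolded T x j α s - k j α * L| ≤ L / 2

theorem abs_sign_mul (k : ℤ) (y : ℝ) : |(-1 : ℝ) ^ k * y| = |y| := by
  rw [abs_mul, abs_zpow, abs_neg, abs_one, one_zpow, one_mul]

theorem foldedPoint_mem_walls (hφ : IsConfinedFlow (L / 2) (tiltedPotential δ L h) φ) {T s : ℝ}
    {x : Phase N} (hx : x ∈ phaseSpace N L) {k : Fin N → Fin 3 → ℤ} (hk : InCell L T x k s) :
    foldedPoint φ L T x k s ∈ phaseSpaceWithWalls N L := by
  have h1 : ∀ j, ∀ α : Fin 3, α ≠ 2 →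
      (foldedPoint φ L T x k s).1 j α ∈ Icc (-(L / 2)) (L / 2) := by
    intro j α hα
    simp only [foldedPoint, if_neg hα]
    exact abs_le.1 ((abs_sign_mul _ _).trans_le (hk j α))
  refine fun j => ⟨h1 j 0 (by decide), h1 j 1 (by decide), ?_⟩
  simpa [foldedPoint] using mem_strip.1 (hφ.mem (s - T) _ (mem_strip.2 (hx j 2)))

theorem foldedPoint_mem_phaseSpace (hφ : IsConfinedFlow (L / 2) (tiltedPotential δ L h) φ)
    {T s : ℝ} {x : Phase N} (hx : x ∈ phaseSpace N L) {k : Fin N → Fin 3 → ℤ}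
    (hk : ∀ j α, |unfolded T x j α s - k j α * L| < L / 2) :
    foldedPoint φ L T x k s ∈ phaseSpace N L := by
  intro j α
  by_cases hα : α = 2
  · subst hα
    simpa [foldedPoint] using mem_strip.1 (hφ.mem (s - T) _ (mem_strip.2 (hx j 2)))
  · simp only [foldedPoint, if_neg hα]
    exact abs_lt.1 ((abs_sign_mul _ _).trans_lt (hk j α))

theorem hasDerivAt_foldedPoint (hφ : IsConfinedFlow (L / 2) (tiltedPotential δ L h) φ) {T : ℝ}
    {x : Phase N} (hx : x ∈ phaseSpace N L) (k : Fin N → Fin 3 → ℤ) (s : ℝ) :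
    HasDerivAt (foldedPoint φ L T x k) (phaseField N δ L h (foldedPoint φ L T x k s)) s := by
  have hd := fun j => (hφ.hasDerivAt (s - T) (x.1 j 2, x.2 j 2)
    (mem_strip.2 (hx j 2))).comp_sub_const s T
  refine HasDerivAt.prodMk ?_ ?_
  · refine hasDerivAt_pi.2 fun j => hasDerivAt_pi.2 fun α => ?_
    by_cases hα : α = 2
    · simpa [phaseField, foldedPoint, hα, hamiltonianField] using (hd j).prod_fst
    · have := (((((hasDerivAt_id s).sub_const T).const_mul (x.2 j α)).const_add
        (x.1 j α)).sub_const (k j α * L)).const_mul ((-1) ^ k j α)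
      simpa [phaseField, foldedPoint, hα, unfolded] using this
  · refine hasDerivAt_pi.2 fun j => hasDerivAt_pi.2 fun α => ?_
    by_cases hα : α = 2
    · simpa [phaseField, foldedPoint, hα, hamiltonianField] using (hd j).prod_snd
    · simpa [phaseField, foldedPoint, hα] using hasDerivAt_const s ((-1) ^ k j α * x.2 j α)

/-- On the common boundary of two cells the two reflections differ by reversals of momenta. -/
theorem adjacent_cells (hL : 0 < L) {y : ℝ} {k l : ℤ} (hk : |y - k * L| ≤ L / 2)
    (hl : |y - l * L| ≤ L / 2) (hkl : k ≠ l) :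
    (-1 : ℝ) ^ l * (y - l * L) = (-1) ^ k * (y - k * L) ∧ (-1 : ℝ) ^ l = -(-1) ^ k ∧
      |y - k * L| = L / 2 := by
  have hk' := abs_le.1 hk
  have hl' := abs_le.1 hl
  rcases lt_or_gt_of_ne hkl with hlt | hlt
  · have h1 : l ≤ k + 1 := by
      by_contra hcon
      have : (k : ℝ) + 2 ≤ l := by exact_mod_cast (by omega : k + 2 ≤ l)
      nlinarith
    obtain rfl : l = k + 1 := by omega
    push_cast at hl' ⊢
    have hy : y - k * L = L / 2 := by linarith
    rw [zpow_add_one₀ (by norm_num)]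
    refine ⟨by rw [add_mul, ← sub_sub, hy]; ring, by ring, by rw [hy, abs_of_pos (by linarith)]⟩
  · have h1 : k ≤ l + 1 := by
      by_contra hcon
      have : (l : ℝ) + 2 ≤ k := by exact_mod_cast (by omega : l + 2 ≤ k)
      nlinarith
    obtain rfl : k = l + 1 := by omega
    push_cast at hk' ⊢
    have hy : y - (l + 1) * L = -(L / 2) := by linarith
    rw [zpow_add_one₀ (by norm_num)]
    refine ⟨by rw [hy, show y - l * L = L / 2 by linarith]; ring, by ring,
      by rw [hy, abs_neg, abs_of_pos (by linarith)]⟩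

/-- The density along the trajectory does not depend on the cell chosen: where two cells meet, the
folded points differ by reversing momenta of coordinates that lie on a wall. -/
theorem IsLiouvilleSolution.foldedPoint_eq {H init : Phase N → ℝ} {ρ : ℝ → Phase N → ℝ}
    (hρ : IsLiouvilleSolution L H init ρ)
    (hφ : IsConfinedFlow (L / 2) (tiltedPotential δ L h) φ) (hL : 0 < L) {T s : ℝ} (hs : 0 ≤ s)
    {x : Phase N} (hx : x ∈ phaseSpace N L) {k l : Fin N → Fin 3 → ℤ} (hk : InCell L T x k s)
    (hl : InCell L T x l s) : ρ s (foldedPoint φ L T x l s) = ρ s (foldedPoint φ L T x k s) := by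
  classical
  set S : Finset (Fin N × Fin 3) := {i | i.2 ≠ 2 ∧ k i.1 i.2 ≠ l i.1 i.2} with hS
  have e : foldedPoint φ L T x l s = flipMomenta S (foldedPoint φ L T x k s) := by
    refine Prod.ext ?_ ?_ <;> ext j α <;> by_cases hα : α = 2
    · simp [foldedPoint, flipMomenta, hα]
    · by_cases hkl : k j α = l j α
      · simp [foldedPoint, flipMomenta, hα, hkl]
      · simpa [foldedPoint, flipMomenta, hα] using (adjacent_cells hL (hk j α) (hl j α) hkl).1
    · simp [foldedPoint, flipMomenta, hα, hS]
    · by_cases hkl : k j α = l j α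
      · simp [foldedPoint, flipMomenta, hα, hkl, hS]
      · simp [foldedPoint, flipMomenta, hα, hkl, hS,
          (adjacent_cells hL (hk j α) (hl j α) hkl).2.1]
  rw [e]
  refine hρ.flipMomenta_eq hs (foldedPoint_mem_walls hφ hx hk) S fun i hi => ?_
  have hi' : i.2 ≠ 2 ∧ k i.1 i.2 ≠ l i.1 i.2 := by simpa [hS] using hi
  refine ⟨hi'.1, ?_⟩
  simp only [foldedPoint, if_neg hi'.1]
  rw [abs_sign_mul]
  exact (adjacent_cells hL (hk _ _) (hl _ _) hi'.2).2.2

/-- The cell containing the unfolded trajectory at time `s`. -/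
noncomputable def cellOf (L T : ℝ) (x : Phase N) (s : ℝ) (j : Fin N) (α : Fin 3) : ℤ :=
  round (unfolded T x j α s / L)

theorem abs_sub_mul_eq (hL : 0 < L) (y : ℝ) (k : ℤ) : |y - k * L| = |y / L - k| * L := by
  rw [← abs_of_pos hL, ← abs_mul, abs_of_pos hL, sub_mul, div_mul_cancel₀ _ hL.ne']

theorem inCell_cellOf (hL : 0 < L) (T : ℝ) (x : Phase N) (s : ℝ) :
    InCell L T x (cellOf L T x s) s := by
  intro j α
  rw [abs_sub_mul_eq hL]
  have := abs_sub_round (unfolded T x j α s / L)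
  rw [cellOf]
  nlinarith

theorem isClosed_inCell (L T : ℝ) (x : Phase N) (k : Fin N → Fin 3 → ℤ) :
    IsClosed {s | InCell L T x k s} := by
  have : {s | InCell L T x k s} = ⋂ j, ⋂ α, {s | |unfolded T x j α s - k j α * L| ≤ L / 2} := by
    ext s; simp [InCell]
  rw [this]
  exact isClosed_iInter fun j => isClosed_iInter fun α =>
    isClosed_le ((continuous_unfolded T x j α).sub continuous_const).abs continuous_const

/-- Local finiteness of the cells, so that continuity at `s₀` can be checked one cell at a time. -/
theorem exists_finite_cells (L T : ℝ) (x : Phase N) (s₀ : ℝ) :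
    ∃ F : Set (Fin N → Fin 3 → ℤ), F.Finite ∧ ∀ᶠ s in 𝓝 s₀, cellOf L T x s ∈ F := by
  refine ⟨Icc (fun j α => ⌊unfolded T x j α s₀ / L⌋ - 2) (fun j α => ⌊unfolded T x j α s₀ / L⌋ + 2),
    Set.finite_Icc _ _, ?_⟩
  have hev : ∀ᶠ s in 𝓝 s₀, ∀ j α,
      |unfolded T x j α s / L - unfolded T x j α s₀ / L| < 1 := by
    rw [eventually_all]
    intro j
    rw [eventually_all]
    intro α
    have hc : Continuous fun s => |unfolded T x j α s / L - unfolded T x j α s₀ / L| :=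
      (((continuous_unfolded T x j α).div_const L).sub continuous_const).abs
    exact hc.continuousAt.eventually_lt continuousAt_const (by simp)
  filter_upwards [hev] with s hs
  have key : ∀ j α, ⌊unfolded T x j α s₀ / L⌋ - 2 ≤ cellOf L T x s j α ∧
      cellOf L T x s j α ≤ ⌊unfolded T x j α s₀ / L⌋ + 2 := by
    intro j α
    have h1 := abs_lt.1 (hs j α)
    have h2 := abs_le.1 (abs_sub_round (unfolded T x j α s / L))
    have h3 := Int.floor_le (unfolded T x j α s₀ / L)
    have h4 := Int.lt_floor_add_one (unfolded T x j α s₀ / L)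
    rw [cellOf]
    constructor
    · have : ((⌊unfolded T x j α s₀ / L⌋ - 2 : ℤ) : ℝ) < round (unfolded T x j α s / L) + 1 := by
        push_cast; linarith
      exact_mod_cast Int.lt_add_one_iff.1 (by exact_mod_cast this)
    · have : ((round (unfolded T x j α s / L) : ℤ) : ℝ) <
          ((⌊unfolded T x j α s₀ / L⌋ + 2 : ℤ) : ℝ) + 1 := by
        push_cast; linarith
      exact_mod_cast Int.lt_add_one_iff.1 (by exact_mod_cast this)
  exact ⟨fun j α => (key j α).1, fun j α => (key j α).2⟩

/-- Pasting over finitely many closed cells. A cell containing the trajectory at `s₀` gives the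
right limit by `foldedPoint_eq`; any other cell is avoided near `s₀`. -/
theorem IsLiouvilleSolution.continuousOn_trajectory {H init : Phase N → ℝ} {ρ : ℝ → Phase N → ℝ}
    (hρ : IsLiouvilleSolution L H init ρ)
    (hφ : IsConfinedFlow (L / 2) (tiltedPotential δ L h) φ) (hL : 0 < L) {T : ℝ}
    {x : Phase N} (hx : x ∈ phaseSpace N L) :
    ContinuousOn (fun s => ρ s (foldedPoint φ L T x (cellOf L T x s) s)) (Ici 0) := by
  intro s₀ hs₀
  rw [ContinuousWithinAt, Metric.tendsto_nhds]
  intro ε hε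
  obtain ⟨F, hF, hFev⟩ := exists_finite_cells L T x s₀
  have hall : ∀ᶠ s in 𝓝[Ici 0] s₀, ∀ k ∈ F, InCell L T x k s →
      dist (ρ s (foldedPoint φ L T x k s))
        (ρ s₀ (foldedPoint φ L T x (cellOf L T x s₀) s₀)) < ε := by
    rw [hF.eventually_all]
    intro k _
    by_cases hk : InCell L T x k s₀
    · rw [hρ.foldedPoint_eq hφ hL hs₀ hx hk (inCell_cellOf hL T x s₀)]
      have hc : ContinuousWithinAt (fun s => ρ s (foldedPoint φ L T x k s))
          (Ici 0 ∩ {s | InCell L T x k s}) s₀ := by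
        have h1 := hρ.continuousOn (s₀, foldedPoint φ L T x k s₀)
          ⟨hs₀, foldedPoint_mem_walls hφ hx hk⟩
        refine ContinuousWithinAt.comp (f := fun s => (s, foldedPoint φ L T x k s)) h1
          (continuousWithinAt_id.prodMk
            (hasDerivAt_foldedPoint hφ hx k s₀).continuousAt.continuousWithinAt) ?_
        exact fun s hs => ⟨hs.1, foldedPoint_mem_walls hφ hx hs.2⟩
      have h2 := Metric.tendsto_nhds.1 hc ε hε
      rw [inter_comm, eventually_nhdsWithin_iff] at h2
      rw [eventually_nhdsWithin_iff]
      filter_upwards [h2] with s hs h0 hks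
      exact hs ⟨hks, h0⟩
    · have : {s | InCell L T x k s}ᶜ ∈ 𝓝 s₀ := (isClosed_inCell L T x k).isOpen_compl.mem_nhds hk
      filter_upwards [mem_nhdsWithin_of_mem_nhds this] with s hs hks
      exact absurd hks hs
  filter_upwards [hall, hFev.filter_mono nhdsWithin_le_nhds] with s h1 h2
  exact h1 _ h2 (inCell_cellOf hL T x s)

theorem countable_reflectionTimes (L T : ℝ) (x : Phase N) :
    {s | ∃ j α, x.2 j α ≠ 0 ∧ ∃ k : ℤ, unfolded T x j α s = (k + 1 / 2) * L}.Countable := by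
  have : {s | ∃ j α, x.2 j α ≠ 0 ∧ ∃ k : ℤ, unfolded T x j α s = (k + 1 / 2) * L} ⊆
      ⋃ j, ⋃ α, ⋃ k : ℤ, {((k + 1 / 2) * L - x.1 j α) / x.2 j α + T} := by
    rintro s ⟨j, α, hp, k, hk⟩
    simp only [mem_iUnion, mem_singleton_iff]
    refine ⟨j, α, k, ?_⟩
    rw [← hk, unfolded]
    field_simp
    ring
  exact (countable_iUnion fun j => countable_iUnion fun α => countable_iUnion fun k =>
    countable_singleton _).mono this

/-- A coordinate with zero momentum rests at its interior position and never meets a wall, which is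
why reflection times only concern nonzero momenta and stay countable. -/
theorem lt_of_not_reflectionTime (hL : 0 < L) {T s : ℝ} {x : Phase N} (hx : x ∈ phaseSpace N L)
    (hs : s ∉ {s | ∃ j α, x.2 j α ≠ 0 ∧ ∃ k : ℤ, unfolded T x j α s = (k + 1 / 2) * L})
    (j : Fin N) (α : Fin 3) : |unfolded T x j α s - cellOf L T x s j α * L| < L / 2 := by
  refine lt_of_le_of_ne (inCell_cellOf hL T x s j α) fun heq => ?_
  have hp : x.2 j α ≠ 0 := by
    intro hp
    have hu : unfolded T x j α s = x.1 j α := by simp [unfolded, hp]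
    have h1 : |x.1 j α / L| < 1 / 2 := by
      rw [abs_div, abs_of_pos hL, div_lt_iff₀ hL]
      have := abs_lt.2 (hx j α)
      linarith
    have h2 : cellOf L T x s j α = 0 := by
      rw [cellOf, hu, round_eq_zero_iff]
      exact ⟨(abs_lt.1 h1).1.le, (abs_lt.1 h1).2⟩
    rw [hu, h2] at heq
    have := abs_lt.2 (hx j α)
    simp at heq
    linarith
  refine hs ⟨j, α, hp, ?_⟩
  rcases (abs_eq (by positivity : 0 ≤ L / 2)).1 heq with h1 | h1
  · exact ⟨cellOf L T x s j α, by linarith⟩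
  · refine ⟨cellOf L T x s j α - 1, ?_⟩
    push_cast
    linarith

theorem cellOf_eventuallyEq (hL : 0 < L) {T s : ℝ} {x : Phase N}
    (hs : ∀ j α, |unfolded T x j α s - cellOf L T x s j α * L| < L / 2) :
    ∀ᶠ r in 𝓝 s, cellOf L T x r = cellOf L T x s := by
  have : ∀ᶠ r in 𝓝 s, ∀ j α, |unfolded T x j α r - cellOf L T x s j α * L| < L / 2 := by
    rw [eventually_all]
    intro j
    rw [eventually_all]
    intro α
    exact ((continuous_unfolded T x j α).sub continuous_const).abs.continuousAt.eventually_lt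
      continuousAt_const (hs j α)
  filter_upwards [this] with r hr
  ext j α
  have h1 := inCell_cellOf hL T x r j α
  by_contra hne
  have := (adjacent_cells hL (hr j α).le h1 (Ne.symm hne)).2.2
  linarith [hr j α]

theorem continuousOn_gibbsDensity :
    ContinuousOn (gibbsDensity β L (H₀ N δ L)) (phaseSpaceWithWalls N L) := by
  intro x hx
  have h1 := (differentiableAt_H₁ (δ := δ) (h := 0) fun j => (hx j).2.2).continuousAt
  rw [H₁_zero] at h1
  exact ((continuousAt_const.mul h1).rexp.div_const _).continuousWithinAt

/-- A backward trajectory may sit on a wall at time zero, where the initial value is not prescribed.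
Shrinking the positions towards the centre reaches such a point from the open box, and continuity
fixes the value. -/
theorem IsLiouvilleSolution.initial_walls {H : Phase N → ℝ} {ρ : ℝ → Phase N → ℝ}
    (hρ : IsLiouvilleSolution L H (gibbsDensity β L (H₀ N δ L)) ρ) {x : Phase N}
    (hx : x ∈ phaseSpaceWithWalls N L) : ρ 0 x = gibbsDensity β L (H₀ N δ L) x := by
  have hxI : ∀ j α, |x.1 j α| ≤ L / 2 := by
    intro j α
    rw [abs_le]
    obtain ⟨h0, h1, h2⟩ := hx j
    fin_cases α
    exacts [h0, h1, ⟨h2.1.le, h2.2.le⟩]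
  -- Positivity of `L` is read off from a particle; for `N = 0` it is not available.
  have hpos : ∀ j : Fin N, 0 < L / 2 := fun j => by linarith [(hx j).2.2.1, (hx j).2.2.2]
  have hmem : ∀ r ∈ Ioo (0 : ℝ) 1, ((r • x.1, x.2) : Phase N) ∈ phaseSpace N L := by
    intro r hr j α
    rw [mem_Ioo, ← abs_lt]
    simp only [Pi.smul_apply, smul_eq_mul, abs_mul, abs_of_pos hr.1]
    have := hpos j
    nlinarith [hxI j α, hr.1, hr.2, abs_nonneg (x.1 j α)]
  have hsub : phaseSpace N L ⊆ phaseSpaceWithWalls N L := fun y hy j =>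
    ⟨Ioo_subset_Icc_self (hy j 0), Ioo_subset_Icc_self (hy j 1), hy j 2⟩
  have htend : Tendsto (fun r : ℝ => ((r • x.1, x.2) : Phase N)) (𝓝[<] 1)
      (𝓝[phaseSpaceWithWalls N L] x) := by
    refine tendsto_nhdsWithin_iff.2 ⟨?_, ?_⟩
    · have : Continuous fun r : ℝ => ((r • x.1, x.2) : Phase N) := by fun_prop
      have h1 := this.tendsto 1
      simp only [one_smul] at h1
      exact h1.mono_left nhdsWithin_le_nhds
    · filter_upwards [Ioo_mem_nhdsLT (zero_lt_one' ℝ)] with r hr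
      exact hsub (hmem r hr)
  have hc : ContinuousOn (ρ 0) (phaseSpaceWithWalls N L) :=
    hρ.continuousOn.comp (f := fun y => ((0 : ℝ), y)) (by fun_prop)
      fun y hy => ⟨mem_Ici.2 le_rfl, hy⟩
  refine tendsto_nhds_unique_of_eventuallyEq ((hc x hx).tendsto.comp htend)
    ((continuousOn_gibbsDensity x hx).tendsto.comp htend) ?_
  filter_upwards [Ioo_mem_nhdsLT (zero_lt_one' ℝ)] with r hr
  exact hρ.initial _ (hmem r hr)

/-- Solutions of Liouville's equation are unique. -/
theorem IsLiouvilleSolution.eq_evolvedDensity {ρ : ℝ → Phase N → ℝ}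
    (hρ : IsLiouvilleSolution L (H₁ N δ L h) (gibbsDensity β L (H₀ N δ L)) ρ)
    (hφ : IsConfinedFlow (L / 2) (tiltedPotential δ L h) φ) (hL : 0 < L) {T : ℝ} (hT : 0 ≤ T)
    {x : Phase N} (hx : x ∈ phaseSpace N L) : ρ T x = evolvedDensity N β δ L φ T x := by
  set f : ℝ → ℝ := fun s => ρ s (foldedPoint φ L T x (cellOf L T x s) s) with hf
  -- Away from the reflection times the derivative along the trajectory is zero, and a continuous
  -- function with zero derivative off a countable set is constant.
  have hconst := integral_eq_of_hasDerivAt_off_countable_of_le f (fun _ => 0) hT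
    (countable_reflectionTimes L T x)
    ((hρ.continuousOn_trajectory hφ hL hx).mono Icc_subset_Ici_self) (fun s hs => ?_) (by simp)
  · rw [intervalIntegral.integral_zero] at hconst
    have hfT : f T = ρ T x := by
      have hcell : cellOf L T x T = 0 := by
        ext j α
        have h1 := abs_lt.2 (hx j α)
        have h2 := abs_lt.1 (show |x.1 j α / L| < 1 / 2 by
          rw [abs_div, abs_of_pos hL, div_lt_iff₀ hL]; linarith)
        simp only [cellOf, unfolded, sub_self, mul_zero, add_zero, Pi.zero_apply,
          round_eq_zero_iff]
        exact ⟨h2.1.le, h2.2⟩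
      have hpt : foldedPoint φ L T x 0 T = x := by
        refine Prod.ext ?_ ?_ <;> ext j α <;> by_cases hα : α = 2 <;>
          simp [foldedPoint, unfolded, hα, hφ.zero]
      simp only [hf, hcell, hpt]
    -- Folding changes horizontal momenta only by signs, which `H₀` does not see.
    have hf0 : f 0 = evolvedDensity N β δ L φ T x := by
      simp only [hf]
      rw [hρ.initial_walls (foldedPoint_mem_walls hφ hx (inCell_cellOf hL T x 0)), gibbsDensity,
        evolvedDensity, H₀_eq]
      have hsq : ∀ (k : ℤ) (p : ℝ), ((-1) ^ k * p) ^ 2 = p ^ 2 := fun k p => by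
        rw [← sq_abs, abs_sign_mul, sq_abs]
      congr 3
      refine Finset.sum_congr rfl fun j _ => ?_
      simp [foldedPoint, hsq]
    rw [← hfT, ← hf0]
    linarith
  · have hlt := lt_of_not_reflectionTime hL hx hs.2
    set k := cellOf L T x s
    have hmem := foldedPoint_mem_phaseSpace hφ hx hlt
    have hd := hρ.differentiableAt s hs.1.1 _ hmem
    have h1 := hd.hasFDerivAt.comp_hasDerivAt (f := fun s => (s, foldedPoint φ L T x k s)) s
      ((hasDerivAt_id s).prodMk (hasDerivAt_foldedPoint hφ hx k s))
    rw [fderiv_uncurry_apply hd, hρ.liouville s hs.1.1 _ hmem,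
      poissonBracket_H₁ fun j => hmem j 2, neg_add_cancel] at h1
    refine h1.congr_of_eventuallyEq ?_
    filter_upwards [cellOf_eventuallyEq hL hlt] with r hr
    simp only [hf, hr, Function.comp_apply]
    rfl

end Uniqueness

end GasInBox

/-! ### Integrals of products over pairs of families. -/

section ProductIntegrals

variable {ι X Y : Type*} [Fintype ι] [MeasureSpace X] [MeasureSpace Y]
  [SigmaFinite (volume : Measure X)] [SigmaFinite (volume : Measure Y)]

theorem integral_prod_arrow_eq_prod (F : ι → X × Y → ℝ) :
    ∫ x : (ι → X) × (ι → Y), ∏ i, F i (x.1 i, x.2 i) = ∏ i, ∫ y, F i y := by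
  rw [← (volume_measurePreserving_arrowProdEquivProdArrow X Y ι).integral_comp',
    ← integral_fintype_prod_volume_eq_prod]
  rfl

theorem integrable_prod_arrow {F : ι → X × Y → ℝ} (hF : ∀ i, Integrable (F i)) :
    Integrable fun x : (ι → X) × (ι → Y) => ∏ i, F i (x.1 i, x.2 i) := by
  rw [← (volume_measurePreserving_arrowProdEquivProdArrow X Y ι).integrable_comp_emb
    (MeasurableEquiv.measurableEmbedding _)]
  exact Integrable.fintype_prod_dep hF

end ProductIntegrals

namespace GasInBox

/-! ### Reduction of the mean of `B` to one vertical degree of freedom. -/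

section Reduction

variable {N : ℕ} {β δ L h : ℝ} {φ : ℝ → ℝ × ℝ → ℝ × ℝ}

theorem measurableSet_phaseSpace (N : ℕ) (L : ℝ) : MeasurableSet (phaseSpace N L) := by
  have : phaseSpace N L =
      ⋂ j, ⋂ α, (fun x : Phase N => x.1 j α) ⁻¹' Ioo (-(L / 2)) (L / 2) := by
    ext x; simp [phaseSpace]
  rw [this]
  refine MeasurableSet.iInter fun j => MeasurableSet.iInter fun α => ?_
  have hm : Measurable fun x : Phase N => x.1 j α :=
    (measurable_pi_apply α).comp ((measurable_pi_apply j).comp measurable_fst)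
  exact hm measurableSet_Ioo

/-- Conservation of the tilted energy: the unperturbed energy changes only by the work `h * z` of
the field. -/
theorem energy_wallPotential_flow (hφ : IsConfinedFlow (L / 2) (tiltedPotential δ L h) φ) (t : ℝ)
    {y : ℝ × ℝ} (hy : y ∈ strip (L / 2)) : energy (wallPotential δ L) (φ t y) =
      energy (tiltedPotential δ L h) y + h * (φ t y).1 := by
  rw [← hφ.energy_eq t y hy]
  simp only [energy, tiltedPotential]
  ring

/-- The factor of the coordinate pair `(j, α)` in the momentum of the particle `k` times the
evolved Gibbs weight. -/
noncomputable def weightFactor (β δ L : ℝ) (φ : ℝ → ℝ × ℝ → ℝ × ℝ) (t : ℝ) (k j : Fin N)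
    (α : Fin 3) : ℝ × ℝ → ℝ :=
  (strip (L / 2)).indicator fun y =>
    if α = 2 then
      (if j = k then y.2 else 1) * Real.exp (-β * energy (wallPotential δ L) (φ (-t) y))
    else Real.exp (-(β / 2) * y.2 ^ 2)

theorem integrableOn_verticalWeight (hβ : 0 < β) (hδ : 0 < δ) (hL : 0 < L)
    (hφ : IsConfinedFlow (L / 2) (tiltedPotential δ L h) φ) (t : ℝ) {g : ℝ × ℝ → ℝ}
    (hg : Continuous g) (hb : ∀ x, |g x| ≤ 1 + x.2 ^ 2) : IntegrableOn
      (fun y => g y * Real.exp (-β * energy (wallPotential δ L) (φ (-t) y))) (strip (L / 2)) := by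
  have := hφ.integrableOn_evolved (confiningPotential_tilted hδ hL h) hβ h t (g := g)
    hg.continuousOn fun x _ => (hb x).trans (by linarith [sq_nonneg (φ (-t) x).2])
  refine this.congr_fun (fun y hy => ?_) (isOpen_strip _).measurableSet
  simp only [energy_wallPotential_flow hφ (-t) hy]

theorem integrable_weightFactor (hβ : 0 < β) (hδ : 0 < δ) (hL : 0 < L)
    (hφ : IsConfinedFlow (L / 2) (tiltedPotential δ L h) φ) (t : ℝ) (k j : Fin N) (α : Fin 3) :
    Integrable (weightFactor β δ L φ t k j α) := by
  rw [weightFactor, integrable_indicator_iff (isOpen_strip _).measurableSet]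
  by_cases hα : α = 2
  · simp only [hα, if_true]
    refine integrableOn_verticalWeight hβ hδ hL hφ t (g := fun y => if j = k then y.2 else 1) ?_ ?_
    · split_ifs <;> fun_prop
    · intro x
      split_ifs
      · rw [abs_le]; constructor <;> nlinarith [sq_nonneg (x.2 - 1), sq_nonneg (x.2 + 1)]
      · simp; positivity
  · simp only [hα, if_false]
    simpa using integrableOn_strip_mul (a := L / 2) (f := fun _ => 1)
      (g := fun p => Real.exp (-(β / 2) * p ^ 2)) (by simp)
      (integrable_exp_neg_mul_sq (by positivity))

/-- Independence of particles and of coordinates: the integrand factorises over both, so the product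
integrals apply twice. -/
theorem prod_weightFactor (t : ℝ) (k : Fin N) (x : Phase N) :
    ∏ j, ∏ α, weightFactor β δ L φ t k j α (x.1 j α, x.2 j α) =
      (phaseSpace N L).indicator
        (fun x => x.2 k 2 * Real.exp (-β * pulledBackEnergy δ L φ t x)) x := by
  by_cases hx : x ∈ phaseSpace N L
  · rw [indicator_of_mem hx]
    have h1 : ∀ j α, (x.1 j α, x.2 j α) ∈ strip (L / 2) := fun j α => mem_strip.2 (hx j α)
    have h2 : ∀ j, ∏ α, weightFactor β δ L φ t k j α (x.1 j α, x.2 j α) =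
        (if j = k then x.2 j 2 else 1) * Real.exp (-β * ((x.2 j 0 ^ 2 + x.2 j 1 ^ 2) / 2 +
          energy (wallPotential δ L) (φ (-t) (x.1 j 2, x.2 j 2)))) := by
      intro j
      rw [Fin.prod_univ_three]
      simp only [weightFactor, indicator_of_mem (h1 j _)]
      rw [if_neg (by decide), if_neg (by decide), if_true, mul_left_comm, ← Real.exp_add,
        ← Real.exp_add]
      congr 2
      ring
    simp only [h2]
    rw [Finset.prod_mul_distrib, Finset.prod_ite_eq' Finset.univ k, if_pos (Finset.mem_univ k),
      ← Real.exp_sum, pulledBackEnergy, Finset.mul_sum]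
  · rw [indicator_of_notMem hx]
    have : ∃ j α, x.1 j α ∉ Ioo (-(L / 2)) (L / 2) := by
      by_contra! hcon
      exact hx hcon
    obtain ⟨j, α, hj⟩ := this
    refine Finset.prod_eq_zero (Finset.mem_univ j) (Finset.prod_eq_zero (Finset.mem_univ α) ?_)
    exact indicator_of_notMem (fun hm => hj (mem_strip.1 hm)) _

theorem integrableOn_momentum_mul (hβ : 0 < β) (hδ : 0 < δ) (hL : 0 < L)
    (hφ : IsConfinedFlow (L / 2) (tiltedPotential δ L h) φ) (t : ℝ) (k : Fin N) :
    IntegrableOn (fun x => x.2 k 2 * Real.exp (-β * pulledBackEnergy δ L φ t x))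
      (phaseSpace N L) := by
  rw [← integrable_indicator_iff (measurableSet_phaseSpace N L)]
  have := integrable_prod_arrow (F := fun (j : Fin N) (y : (Fin 3 → ℝ) × (Fin 3 → ℝ)) =>
    ∏ α, weightFactor β δ L φ t k j α (y.1 α, y.2 α)) fun j =>
      integrable_prod_arrow fun α => integrable_weightFactor hβ hδ hL hφ t k j α
  exact this.congr (Eventually.of_forall fun x => prod_weightFactor t k x)

/-- All factors except the vertical one of particle `k` are constant in time: the horizontal ones
trivially, the vertical ones of the other particles by Liouville's theorem. Of `C` only the sign and
the independence of `t` matter. -/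
theorem exists_integral_momentum_mul_eq
    (hφ : IsConfinedFlow (L / 2) (tiltedPotential δ L h) φ) (k : Fin N) :
    ∃ C : ℝ, 0 ≤ C ∧ ∀ t, ∫ x in phaseSpace N L,
      x.2 k 2 * Real.exp (-β * pulledBackEnergy δ L φ t x) =
      C * ∫ y in strip (L / 2), y.2 *
        Real.exp (-β * (energy (tiltedPotential δ L h) y + h * (φ (-t) y).1)) := by
  have hms := (isOpen_strip (L / 2)).measurableSet
  set G := ∫ y in strip (L / 2), Real.exp (-(β / 2) * y.2 ^ 2) with hG
  set W := ∫ y in strip (L / 2), Real.exp (-β * energy (wallPotential δ L) y) with hW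
  have hG0 : 0 ≤ G := integral_nonneg fun _ => Real.exp_nonneg _
  have hW0 : 0 ≤ W := integral_nonneg fun _ => Real.exp_nonneg _
  refine ⟨G * G * ∏ j ∈ Finset.univ.erase k, (G * G * W), by positivity, fun t => ?_⟩
  rw [← integral_indicator (measurableSet_phaseSpace N L)]
  have h1 := integral_prod_arrow_eq_prod (F := fun (j : Fin N)
    (y : (Fin 3 → ℝ) × (Fin 3 → ℝ)) => ∏ α, weightFactor β δ L φ t k j α (y.1 α, y.2 α))
  simp only [prod_weightFactor, integral_prod_arrow_eq_prod] at h1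
  rw [h1, ← Finset.mul_prod_erase _ _ (Finset.mem_univ k)]
  have hhor : ∀ j, ∀ α : Fin 3, α ≠ 2 → ∫ y, weightFactor β δ L φ t k j α y = G := by
    intro j α hα
    rw [weightFactor, integral_indicator hms]
    simp only [if_neg hα, hG]
  have hself : ∫ y, weightFactor β δ L φ t k k 2 y = ∫ y in strip (L / 2), y.2 *
      Real.exp (-β * (energy (tiltedPotential δ L h) y + h * (φ (-t) y).1)) := by
    rw [weightFactor, integral_indicator hms]
    refine setIntegral_congr_fun hms fun y hy => ?_
    simp [energy_wallPotential_flow hφ (-t) hy]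
  have hother : ∀ j ∈ Finset.univ.erase k, ∫ y, weightFactor β δ L φ t k j 2 y = W := by
    intro j hj
    rw [weightFactor, integral_indicator hms]
    simp only [if_true, if_neg (Finset.ne_of_mem_erase hj), one_mul]
    exact hφ.integral_comp (-t) fun y => Real.exp (-β * energy (wallPotential δ L) y)
  rw [Fin.prod_univ_three, hhor k 0 (by decide), hhor k 1 (by decide), hself]
  have hprod : ∏ j ∈ Finset.univ.erase k, ∏ α, ∫ y, weightFactor β δ L φ t k j α y =
      ∏ j ∈ Finset.univ.erase k, (G * G * W) := by
    refine Finset.prod_congr rfl fun j hj => ?_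
    rw [Fin.prod_univ_three, hhor j 0 (by decide), hhor j 1 (by decide), hother j hj]
  rw [hprod]
  ring

theorem B_mul_evolvedDensity {x : Phase N} (hx : x ∈ phaseSpace N L) (t : ℝ) :
    B N δ L x * evolvedDensity N β δ L φ t x =
      ∑ k, x.2 k 2 * Real.exp (-β * pulledBackEnergy δ L φ t x) /
        ∫ y in phaseSpace N L, Real.exp (-β * H₀ N δ L y) := by
  rw [B_eq hx, evolvedDensity, Finset.sum_mul]
  exact Finset.sum_congr rfl fun k _ => (mul_div_assoc _ _ _).symm

theorem integrableOn_B_mul (hβ : 0 < β) (hδ : 0 < δ) (hL : 0 < L)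
    (hφ : IsConfinedFlow (L / 2) (tiltedPotential δ L h) φ) (t : ℝ) :
    IntegrableOn (fun x => B N δ L x * evolvedDensity N β δ L φ t x) (phaseSpace N L) := by
  refine IntegrableOn.congr_fun (f := fun x : Phase N => ∑ k, x.2 k 2 *
    Real.exp (-β * pulledBackEnergy δ L φ t x) /
      ∫ y in phaseSpace N L, Real.exp (-β * H₀ N δ L y)) ?_
    (fun x hx => (B_mul_evolvedDensity hx t).symm) (measurableSet_phaseSpace N L)
  exact integrable_finsetSum _ fun k _ => (integrableOn_momentum_mul hβ hδ hL hφ t k).div_const _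

theorem exists_mean_eq (hβ : 0 < β) (hδ : 0 < δ) (hL : 0 < L)
    (hφ : IsConfinedFlow (L / 2) (tiltedPotential δ L h) φ) :
    ∃ C : ℝ, 0 ≤ C ∧ ∀ t, mean L (B N δ L) (evolvedDensity N β δ L φ) t =
      C * ∫ y in strip (L / 2), y.2 *
        Real.exp (-β * (energy (tiltedPotential δ L h) y + h * (φ (-t) y).1)) := by
  choose C hC0 hC using fun k : Fin N => exists_integral_momentum_mul_eq (β := β) hφ k
  have hZ : 0 ≤ ∫ y in phaseSpace N L, Real.exp (-β * H₀ N δ L y) :=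
    integral_nonneg fun _ => Real.exp_nonneg _
  refine ⟨∑ k, C k / ∫ y in phaseSpace N L, Real.exp (-β * H₀ N δ L y),
    Finset.sum_nonneg fun k _ => div_nonneg (hC0 k) hZ, fun t => ?_⟩
  rw [mean, setIntegral_congr_fun (measurableSet_phaseSpace N L) fun x hx =>
    B_mul_evolvedDensity hx t, integral_finsetSum _ fun k _ =>
      (integrableOn_momentum_mul hβ hδ hL hφ t k).div_const _, Finset.sum_mul]
  refine Finset.sum_congr rfl fun k _ => ?_
  rw [integral_div, hC]
  ring

end Reduction

end GasInBox

/-! ### The bound on the relaxation time. -/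

theorem theorem2 (N : ℕ) (β δ L : ℝ) (hβ : 0 < β) (hδ : 0 < δ) (hL : 0 < L)
    (hβδ : (β * δ) ^ (1 / 12 : ℝ) < L / 3) :
    |GasInBox.c - 25| < 1 ∧
    ∀ᶠ h : ℝ in 𝓝[>] 0,
      (∃ ρ : ℝ → GasInBox.Phase N → ℝ,
        GasInBox.IsLiouvilleSolution L (GasInBox.H₁ N δ L h)
          (GasInBox.gibbsDensity β L (GasInBox.H₀ N δ L)) ρ) ∧
      ∀ ρ : ℝ → GasInBox.Phase N → ℝ,
        GasInBox.IsLiouvilleSolution L (GasInBox.H₁ N δ L h)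
          (GasInBox.gibbsDensity β L (GasInBox.H₀ N δ L)) ρ →
        (∀ t, 0 ≤ t →
          IntegrableOn (fun x => GasInBox.B N δ L x * ρ t x) (GasInBox.phaseSpace N L)) ∧
        (GasInBox.t₀ β δ L : EReal) ≤
          GasInBox.relaxationTime (GasInBox.meanIncrement L (GasInBox.B N δ L) ρ) := by
  refine ⟨GasInBox.abs_c_sub_lt, ?_⟩
  filter_upwards [GasInBox.eventually_force_le hβ hδ hL hβδ, self_mem_nhdsWithin] with h hforce hh
  have hh0 : 0 ≤ h := le_of_lt hh
  have hU := GasInBox.confiningPotential_tilted hδ hL h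
  obtain ⟨φ, hφ⟩ := hU.exists_isConfinedFlow
  refine ⟨⟨_, GasInBox.isLiouvilleSolution_evolvedDensity hφ⟩, fun ρ hρ => ?_⟩
  have heq : ∀ t, 0 ≤ t → EqOn (fun x => GasInBox.B N δ L x * ρ t x)
      (fun x => GasInBox.B N δ L x * GasInBox.evolvedDensity N β δ L φ t x)
      (GasInBox.phaseSpace N L) := fun t ht x hx => by
    simp only [hρ.eq_evolvedDensity hφ hL ht hx]
  have hms := GasInBox.measurableSet_phaseSpace N L
  refine ⟨fun t ht => (GasInBox.integrableOn_B_mul hβ hδ hL hφ t).congr_fun (heq t ht).symm hms,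
    -- `t₀` itself belongs to the set whose supremum is the relaxation time.
    le_sSup fun t ht htt => ?_⟩
  have htt' : t < GasInBox.t₀ β δ L := EReal.coe_lt_coe_iff.1 htt
  obtain ⟨C, hC0, hC⟩ := GasInBox.exists_mean_eq (N := N) hβ hδ hL hφ
  have hmean : ∀ t, 0 ≤ t → GasInBox.mean L (GasInBox.B N δ L) ρ t =
      C * ∫ y in strip (L / 2), y.2 *
        Real.exp (-β * (energy (GasInBox.tiltedPotential δ L h) y + h * (φ (-t) y).1)) := by
    intro t ht
    rw [← hC]
    exact setIntegral_congr_fun hms (heq t ht)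
  have hd := ((hφ.hasDerivAt_meanMomentum hU hβ h t).const_mul C).sub_const
    (GasInBox.mean L (GasInBox.B N δ L) ρ 0)
  -- The formula for the mean is known only at nonnegative times, which contain a neighbourhood of
  -- `t > 0`.
  have hd' := hd.congr_of_eventuallyEq (f₁ := GasInBox.meanIncrement L (GasInBox.B N δ L) ρ) <| by
    filter_upwards [lt_mem_nhds ht] with s hs
    rw [GasInBox.meanIncrement, hmean s hs.le]
  refine ⟨hd'.differentiableAt, ?_⟩
  rw [hd'.deriv]
  exact mul_nonneg hC0 (mul_nonneg (mul_nonneg hβ.le hh0)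
    (GasInBox.integral_momentum_mul_nonneg_of_le hβ hδ hL hh0 hforce hφ ht.le htt'.le))
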